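/- Let $\Bbbk$ be a field of characteristic zero and let $W_+$ be the positive Witt algebra: the Lie algebra over $\Bbbk$ with basis $e_i$ ($i\ge 1$) and bracket $[e_i,e_j]=(j-i)e_{i+j}$. Let $\mathrm{U}(W_+)$ be its enveloping algebra and $\mathrm{S}(W_+)=\Bbbk[x_1,x_2,\dots]$ its symmetric algebra ($x_i$ being the image of $e_i$), with the Poisson bracket determined by $\{x_i,x_j\}=(j-i)x_{i+j}$. *Gradings, filtrations and associated graded ideals.* $\mathrm{U}(W_+)$ is graded by degree, $d(e_i)=i$; for an ideal $J$, $\operatorname{gr}_d(J)\triangleleft \mathrm{U}(W_+)$ is the ideal spanned by the $d$-homogeneous components of highest degree of the elements of $J$. For weights $w(e_i)\in\mathbb N$, filter $\mathrm{U}(W_+)$ by letting the $n$-th piece be the span of the products $e_{i_1}\cdots e_{i_r}$ with $\sum_j w(e_{i_j})\le n$. With $w(e_i)=1$ this is the order filtration $o$, with $w(e_i)=i+1$ it is the degree-order filtration $do$; in both cases the associated graded algebra is $\mathrm{S}(W_+)$ (by the Poincaré–Birkhoff–Witt theorem), and for an ideal $I$ of $\mathrm{U}(W_+)$ we write $\operatorname{gr}_o(I)$,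 $\operatorname{gr}_{do}(I)\triangleleft \mathrm{S}(W_+)$ for the ideals spanned by the leading symbols of the elements of $I$. The ideal $\operatorname{gr}_o(I)$ is a Poisson ideal if $I$ is two-sided. *Dimensions.* For $f:\mathbb N\to\mathbb N$ let $\gamma(f)\in[0,\infty]$ be the infimum of the real $\gamma\ge 0$ such that, for some $c,m\in\mathbb N$, $f(n)\le c(mn)^\gamma$ for all but finitely many $n$. For a $\Bbbk$-algebra $R$, $\operatorname{GK} R=\sup_V\gamma\big(n\mapsto\dim\sum_{i=0}^n V^i\big)$, and for a (commutative) Poisson algebra $A$, $\operatorname{PGKdim} A=\sup_V\gamma\big(n\mapsto\dim\sum_{i=0}^n V^{\{i\}}\big)$, where $V^{\{0\}}=\Bbbk$ and $V^{\{n+1\}}=VV^{\{n\}}+\{V,V^{\{n\}}\}$; in both cases $V$ runs over the finite-dimensional subspaces. **Theorem.** Let $J$ be a two-sided ideal of $\mathrm{U}(W_+)$, let $I=\operatorname{gr}_d(J)$ and $K=\operatorname{gr}_o(I)$. Then $K=\operatorname{gr}_{do}(I)$ and $$\operatorname{GK}\,\mathrm{U}(W_+)/J=\operatorname{GK}\,\mathrm{U}(W_+)/I=\operatorname{PGKdim}\,\mathrm{S}(W_+)/K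 .$$ -/

import Mathlib

open scoped NNReal ENNReal

noncomputable section

/-! ### Growth of functions and Gelfand–Kirillov dimension -/

/-- `f ≤* g`: there are `c, m ∈ ℕ` with `f n ≤ c * g (m * n)` for all but finitely many `n`. -/
def GrowthLE (f g : ℕ → ℝ) : Prop :=
  ∃ c m : ℕ, ∀ᶠ n in Filter.atTop, f n ≤ c * g (m * n)

/-- `inf {γ ≥ 0 : 𝒢(f) ≤ 𝒢(n ↦ n ^ γ)} ∈ [0, ∞]`; the infimum of the empty set is `∞`. -/
def growthExponent (f : ℕ → ℕ) : ℝ≥0∞ :=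
  ⨅ (γ : ℝ≥0) (_ : GrowthLE (fun n => (f n : ℝ)) (fun n => (n : ℝ) ^ (γ : ℝ))), (γ : ℝ≥0∞)

/-- `d_V(n) = dim (∑_{i ≤ n} V ^ i)`. -/
def growthFun {k R : Type*} [Field k] [Ring R] [Algebra k R] (V : Submodule k R) (n : ℕ) : ℕ :=
  Module.finrank k (↥(⨆ i ∈ Finset.range (n + 1), V ^ i))

/-- The Gelfand–Kirillov dimension: the supremum, over all finite-dimensional subspaces `V`
(equivalently, over all finitely generated subalgebras `k⟨V⟩`), of the growth exponent of `d_V`. -/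
def GKdim (k R : Type*) [Field k] [Ring R] [Algebra k R] : ℝ≥0∞ :=
  ⨆ (V : Submodule k R) (_ : V.FG), growthExponent (growthFun V)

/-! ### Poisson algebras and Poisson Gelfand–Kirillov dimension -/

/-- A (commutative) Poisson algebra over `k`. -/
class PoissonAlgebra (k A : Type*) [Field k] [CommRing A] [Algebra k A] where
  /-- The Poisson bracket. -/
  pb : A →ₗ[k] A →ₗ[k] A
  pb_self : ∀ a, pb a a = 0
  pb_jacobi : ∀ a b c, pb a (pb b c) + pb b (pb c a) + pb c (pb a b) = 0
  pb_mul : ∀ a b c, pb a (b * c) = pb a b * c + b * pb a c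

/-- `V^{0} = k`, `V^{n+1} = V V^{n} + {V, V^{n}}`. -/
def poissonPow {k A : Type*} [Field k] [CommRing A] [Algebra k A] [PoissonAlgebra k A]
    (V : Submodule k A) : ℕ → Submodule k A
  | 0 => 1
  | n + 1 => V * poissonPow V n ⊔ Submodule.map₂ PoissonAlgebra.pb V (poissonPow V n)

/-- `pd_V(n) = dim (∑_{i ≤ n} V^{i})`. -/
def poissonGrowthFun {k A : Type*} [Field k] [CommRing A] [Algebra k A] [PoissonAlgebra k A]
    (V : Submodule k A) (n : ℕ) : ℕ :=
  Module.finrank k (↥(⨆ i ∈ Finset.range (n + 1), poissonPow V i))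

/-- The Poisson Gelfand–Kirillov dimension: the supremum, over all finite-dimensional subspaces `V`
(equivalently, over all finitely generated Poisson subalgebras), of the growth exponent
of `pd_V`. -/
def PGKdim (k A : Type*) [Field k] [CommRing A] [Algebra k A] [PoissonAlgebra k A] : ℝ≥0∞ :=
  ⨆ (V : Submodule k A) (_ : V.FG), growthExponent (poissonGrowthFun V)

/-- A Poisson ideal: an ideal `K` with `{A, K} ⊆ K`. -/
class IsPoissonIdeal (k : Type*) {A : Type*} [Field k] [CommRing A] [Algebra k A]
    [PoissonAlgebra k A] (K : Ideal A) : Prop where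
  pb_mem : ∀ (a : A) {b : A}, b ∈ K → PoissonAlgebra.pb (k := k) a b ∈ K

section Quotient

variable {k A : Type*} [Field k] [CommRing A] [Algebra k A] [PoissonAlgebra k A]

theorem PoissonAlgebra.pb_swap (a b : A) :
    PoissonAlgebra.pb (k := k) a b = -PoissonAlgebra.pb (k := k) b a := by
  have h := PoissonAlgebra.pb_self (k := k) (a + b)
  simp only [map_add, LinearMap.add_apply, PoissonAlgebra.pb_self, zero_add, add_zero] at h
  exact eq_neg_of_add_eq_zero_right h

/-- The induced bracket `{a + K, b + K} = {a, b} + K` on the quotient by a Poisson ideal. -/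
def quotientBracket (K : Ideal A) [hK : IsPoissonIdeal k K] (x y : A ⧸ K) : A ⧸ K :=
  Quotient.liftOn₂' x y (fun a b => Ideal.Quotient.mk K (PoissonAlgebra.pb (k := k) a b)) <| by
    intro a b a' b' ha hb
    rw [Submodule.quotientRel_def] at ha hb
    rw [Ideal.Quotient.eq]
    have h : PoissonAlgebra.pb (k := k) a b - PoissonAlgebra.pb (k := k) a' b'
        = -PoissonAlgebra.pb (k := k) b (a - a') + PoissonAlgebra.pb (k := k) a' (b - b') := by
      rw [← PoissonAlgebra.pb_swap]
      simp only [map_sub, LinearMap.sub_apply]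
      abel
    rw [h]
    exact K.add_mem (K.neg_mem (hK.pb_mem _ ha)) (hK.pb_mem _ hb)

theorem quotientBracket_mk (K : Ideal A) [IsPoissonIdeal k K] (a b : A) :
    quotientBracket (k := k) K (Ideal.Quotient.mk K a) (Ideal.Quotient.mk K b)
      = Ideal.Quotient.mk K (PoissonAlgebra.pb (k := k) a b) := rfl

/-- The quotient of a Poisson algebra by a Poisson ideal. -/
instance quotientPoissonAlgebra (K : Ideal A) [IsPoissonIdeal k K] :
    PoissonAlgebra k (A ⧸ K) where
  pb := LinearMap.mk₂ k (quotientBracket (k := k) K)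
    (by
      intro x x' y
      obtain ⟨a, rfl⟩ := Ideal.Quotient.mk_surjective x
      obtain ⟨a', rfl⟩ := Ideal.Quotient.mk_surjective x'
      obtain ⟨b, rfl⟩ := Ideal.Quotient.mk_surjective y
      rw [← map_add, quotientBracket_mk, map_add, LinearMap.add_apply, map_add]
      rfl)
    (by
      intro c x y
      obtain ⟨a, rfl⟩ := Ideal.Quotient.mk_surjective x
      obtain ⟨b, rfl⟩ := Ideal.Quotient.mk_surjective y
      change quotientBracket (k := k) K (Ideal.Quotient.mk K (c • a)) _ =
        Ideal.Quotient.mk K (c • _)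
      simp only [quotientBracket_mk, map_smul, LinearMap.smul_apply])
    (by
      intro x y y'
      obtain ⟨a, rfl⟩ := Ideal.Quotient.mk_surjective x
      obtain ⟨b, rfl⟩ := Ideal.Quotient.mk_surjective y
      obtain ⟨b', rfl⟩ := Ideal.Quotient.mk_surjective y'
      rw [← map_add, quotientBracket_mk, map_add, map_add]
      rfl)
    (by
      intro c x y
      obtain ⟨a, rfl⟩ := Ideal.Quotient.mk_surjective x
      obtain ⟨b, rfl⟩ := Ideal.Quotient.mk_surjective y
      change quotientBracket (k := k) K _ (Ideal.Quotient.mk K (c • b)) =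
        Ideal.Quotient.mk K (c • _)
      simp only [quotientBracket_mk, map_smul])
  pb_self x := by
    obtain ⟨a, rfl⟩ := Ideal.Quotient.mk_surjective x
    simp only [LinearMap.mk₂_apply, quotientBracket_mk, PoissonAlgebra.pb_self, map_zero]
  pb_jacobi x y z := by
    obtain ⟨a, rfl⟩ := Ideal.Quotient.mk_surjective x
    obtain ⟨b, rfl⟩ := Ideal.Quotient.mk_surjective y
    obtain ⟨c, rfl⟩ := Ideal.Quotient.mk_surjective z
    simp only [LinearMap.mk₂_apply, quotientBracket_mk]
    rw [← map_add, ← map_add, PoissonAlgebra.pb_jacobi, map_zero]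
  pb_mul x y z := by
    obtain ⟨a, rfl⟩ := Ideal.Quotient.mk_surjective x
    obtain ⟨b, rfl⟩ := Ideal.Quotient.mk_surjective y
    obtain ⟨c, rfl⟩ := Ideal.Quotient.mk_surjective z
    simp only [LinearMap.mk₂_apply]
    rw [← map_mul, quotientBracket_mk, PoissonAlgebra.pb_mul, map_add, map_mul, map_mul]
    rfl

end Quotient

/-! ### The positive Witt algebra -/

/-- The underlying vector space of the positive Witt algebra, with basis `e_i`, `i ≥ 1`. -/
def WittPos (k : Type*) [Field k] : Type _ := ℕ+ →₀ k

namespace WittPos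

variable (k : Type*) [Field k]

instance : AddCommGroup (WittPos k) := inferInstanceAs (AddCommGroup (ℕ+ →₀ k))

instance : Module k (WittPos k) := inferInstanceAs (Module k (ℕ+ →₀ k))

/-- The basis `(e_i)`, `i ≥ 1`. -/
def basis : Module.Basis ℕ+ k (WittPos k) :=
  Module.Basis.ofRepr (LinearEquiv.refl k (ℕ+ →₀ k))

/-- The basis vector `e_i`. -/
def e (i : ℕ+) : WittPos k := basis k i

/-- The bilinear map with `[e_i, e_j] = (j - i) e_{i+j}`. -/
def bracket : WittPos k →ₗ[k] WittPos k →ₗ[k] WittPos k :=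
  (basis k).constr k fun i => (basis k).constr k fun j => (((j : ℕ) : k) - ((i : ℕ) : k)) • e k (i + j)

theorem bracket_e (i j : ℕ+) :
    bracket k (e k i) (e k j) = (((j : ℕ) : k) - ((i : ℕ) : k)) • e k (i + j) := by
  simp [bracket, e]

theorem bracket_swap (x y : WittPos k) : bracket k x y = -bracket k y x := by
  have h : bracket k = -(bracket k).flip := by
    refine (basis k).ext fun i => (basis k).ext fun j => ?_
    change bracket k (e k i) (e k j) = -(bracket k (e k j) (e k i))
    rw [bracket_e, bracket_e, ← neg_smul, add_comm j i, neg_sub]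
  exact congrArg (fun f => f x y) h

theorem e_induction {P : WittPos k → Prop} (mem : ∀ i, P (e k i)) (zero : P 0)
    (add : ∀ x y, P x → P y → P (x + y)) (smul : ∀ (c : k) x, P x → P (c • x))
    (x : WittPos k) : P x := by
  have hx : x ∈ Submodule.span k (Set.range (basis k)) := (basis k).mem_span x
  induction hx using Submodule.span_induction with
  | mem y hy => obtain ⟨i, rfl⟩ := hy; exact mem i
  | zero => exact zero
  | add y z _ _ hy hz => exact add y z hy hz
  | smul c y _ hy => exact smul c y hy

theorem bracket_self (x : WittPos k) : bracket k x x = 0 := by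
  induction x using e_induction with
  | zero => simp
  | smul c x hx => simp [hx]
  | add x y hx hy => simp [hx, hy, bracket_swap k x y]
  | mem i => simp [bracket_e]

theorem bracket_leibniz (x y z : WittPos k) :
    bracket k x (bracket k y z) = bracket k (bracket k x y) z + bracket k y (bracket k x z) := by
  induction x using e_induction with
  | zero => simp
  | smul c x hx => simp [hx]
  | add x y hx hy => simp only [map_add, LinearMap.add_apply, hx, hy]; abel
  | mem i =>
  induction y using e_induction with
  | zero => simp
  | smul c x hx => simp [hx]
  | add x y hx hy => simp only [map_add, LinearMap.add_apply, hx, hy]; abel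
  | mem j =>
  induction z using e_induction with
  | zero => simp
  | smul c x hx => simp [hx]
  | add x y hx hy => simp only [map_add, hx, hy]; abel
  | mem l =>
  simp only [bracket_e, map_smul, LinearMap.smul_apply, smul_smul]
  rw [show i + j + l = i + (j + l) from add_assoc i j l,
    show j + (i + l) = i + (j + l) from add_left_comm j i l, ← add_smul]
  congr 1
  push_cast
  ring

/-- The Lie bracket of `W₊`. -/
instance : LieRing (WittPos k) where
  bracket x y := bracket k x y
  add_lie x y z := by simp
  lie_add x y z := by simp
  lie_self x := bracket_self k x
  leibniz_lie x y z := bracket_leibniz k x y z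

instance : LieAlgebra k (WittPos k) where
  lie_smul c x y := (bracket k x).map_smul c y

theorem lie_e (i j : ℕ+) :
    ⁅e k i, e k j⁆ = (((j : ℕ) : k) - ((i : ℕ) : k)) • e k (i + j) :=
  bracket_e k i j

end WittPos

/-! ### The symmetric algebra `S(W₊)` with its Poisson bracket -/

/-- The symmetric algebra `S(W₊)`. -/
abbrev SymW (k : Type*) [Field k] : Type _ := SymmetricAlgebra k (WittPos k)

namespace SymW

variable (k : Type*) [Field k]

/-- `x_i ∈ S(W₊)`, the image of `e_i`. -/
def x (i : ℕ+) : SymW k := SymmetricAlgebra.ι k (WittPos k) (WittPos.e k i)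

/-- The identification `S(W₊) = k[x_1, x_2, …]`. -/
def equivPoly : SymW k ≃ₐ[k] MvPolynomial ℕ+ k :=
  SymmetricAlgebra.equivMvPolynomial (WittPos.basis k)

/-- The derivation `{x_j, -}` of `k[x_1, x_2, …]`, with `{x_j, x_i} = (i - j) x_{i+j}`. -/
def ham (j : ℕ+) : Derivation k (MvPolynomial ℕ+ k) (MvPolynomial ℕ+ k) :=
  MvPolynomial.mkDerivation k fun i =>
    (((i : ℕ) : k) - ((j : ℕ) : k)) • MvPolynomial.X (i + j)

/-- The derivation `{f, -}` of `k[x_1, x_2, …]`, with `{f, x_j} = -{x_j, f}`. -/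
def hamP (f : MvPolynomial ℕ+ k) : Derivation k (MvPolynomial ℕ+ k) (MvPolynomial ℕ+ k) :=
  MvPolynomial.mkDerivation k fun j => -ham k j f

theorem hamP_X (f : MvPolynomial ℕ+ k) (j : ℕ+) : hamP k f (MvPolynomial.X j) = -ham k j f := by
  simp [hamP]

theorem hamP_X_X (i j : ℕ+) : hamP k (MvPolynomial.X i) (MvPolynomial.X j) =
    (((j : ℕ) : k) - ((i : ℕ) : k)) • MvPolynomial.X (i + j) := by
  rw [hamP_X, ham, MvPolynomial.mkDerivation_X, ← neg_smul, neg_sub]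

theorem hamP_add (f g : MvPolynomial ℕ+ k) : hamP k (f + g) = hamP k f + hamP k g := by
  refine MvPolynomial.derivation_ext fun j => ?_
  rw [Derivation.add_apply]
  simp only [hamP_X, map_add]
  ring

theorem hamP_smul (c : k) (f : MvPolynomial ℕ+ k) : hamP k (c • f) = c • hamP k f := by
  refine MvPolynomial.derivation_ext fun j => ?_
  rw [Derivation.smul_apply]
  rw [hamP_X, hamP_X, Derivation.map_smul, smul_neg]

theorem hamP_mul (f g : MvPolynomial ℕ+ k) : hamP k (f * g) = f • hamP k g + g • hamP k f := by
  refine MvPolynomial.derivation_ext fun j => ?_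
  rw [Derivation.add_apply, Derivation.smul_apply, Derivation.smul_apply]
  simp only [hamP_X, Derivation.leibniz, smul_eq_mul]
  ring

theorem hamP_C (c : k) : hamP k (MvPolynomial.C c) = 0 := by
  refine MvPolynomial.derivation_ext fun j => ?_
  simp only [hamP_X, MvPolynomial.derivation_C, neg_zero, Derivation.zero_apply]

theorem hamP_X_eq (i : ℕ+) : hamP k (MvPolynomial.X i) = ham k i := by
  refine MvPolynomial.derivation_ext fun j => ?_
  rw [hamP_X_X, ham, MvPolynomial.mkDerivation_X, add_comm]

theorem hamP_swap (f g : MvPolynomial ℕ+ k) : hamP k f g = -hamP k g f := by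
  induction g using MvPolynomial.induction_on with
  | C c => simp [hamP_C, MvPolynomial.derivation_C]
  | add p q hp hq => rw [map_add, hamP_add, Derivation.add_apply, hp, hq]; ring
  | mul_X p j hp =>
    rw [Derivation.leibniz, hamP_mul, Derivation.add_apply, Derivation.smul_apply,
      Derivation.smul_apply, hp, hamP_X, hamP_X_eq]
    simp only [smul_eq_mul]
    ring

theorem hamP_self (f : MvPolynomial ℕ+ k) : hamP k f f = 0 := by
  induction f using MvPolynomial.induction_on with
  | C c => simp [hamP_C]
  | add p q hp hq =>
    rw [map_add, hamP_add, Derivation.add_apply, Derivation.add_apply, hp, hq, hamP_swap k p q]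
    ring
  | mul_X p j hp =>
    rw [Derivation.leibniz, hamP_mul]
    simp only [Derivation.add_apply, Derivation.smul_apply, smul_eq_mul, hp]
    rw [hamP_X_X, sub_self, zero_smul, hamP_swap k p]
    ring

theorem hamP_jacobi (f g h : MvPolynomial ℕ+ k) :
    hamP k f (hamP k g h) = hamP k (hamP k f g) h + hamP k g (hamP k f h) := by
  have step : ∀ p q g h : MvPolynomial ℕ+ k,
      hamP k p (hamP k g h) = hamP k (hamP k p g) h + hamP k g (hamP k p h) →
      hamP k q (hamP k g h) = hamP k (hamP k q g) h + hamP k g (hamP k q h) →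
      hamP k (p * q) (hamP k g h)
        = hamP k (hamP k (p * q) g) h + hamP k g (hamP k (p * q) h) := by
    intro p q g h hp hq
    simp only [hamP_mul, hamP_add, Derivation.add_apply, Derivation.smul_apply, map_add,
      Derivation.leibniz, smul_eq_mul, hp, hq]
    rw [hamP_swap k g p, hamP_swap k g q]
    ring
  have hC : ∀ (c : k) (g h : MvPolynomial ℕ+ k), hamP k (MvPolynomial.C c) (hamP k g h)
      = hamP k (hamP k (MvPolynomial.C c) g) h + hamP k g (hamP k (MvPolynomial.C c) h) := by
    intro c g h
    have h0 : hamP k 0 = 0 := by simpa using hamP_C k 0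
    simp [hamP_C, h0]
  have flip : ∀ f g h : MvPolynomial ℕ+ k,
      hamP k f (hamP k g h) = hamP k (hamP k f g) h + hamP k g (hamP k f h) →
      hamP k g (hamP k f h) = hamP k (hamP k g f) h + hamP k f (hamP k g h) := by
    intro f g h H
    have hneg : hamP k (hamP k g f) h = -hamP k (hamP k f g) h := by
      rw [hamP_swap k g f, hamP_swap k (-_) h, map_neg, neg_neg, hamP_swap k h]
    rw [hneg, H]
    ring
  have hXX : ∀ (i j : ℕ+) (h : MvPolynomial ℕ+ k),
      hamP k (.X i) (hamP k (.X j) h)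
        = hamP k (hamP k (.X i) (.X j)) h + hamP k (.X j) (hamP k (.X i) h) := by
    intro i j h
    induction h using MvPolynomial.induction_on with
    | C c => simp [MvPolynomial.derivation_C]
    | add p q hp hq => simp only [map_add, hp, hq]; ring
    | mul_X p l hp =>
      have hl : hamP k (.X i) (hamP k (.X j) (.X l))
          = hamP k (hamP k (.X i) (.X j)) (.X l) + hamP k (.X j) (hamP k (.X i) (.X l)) := by
        simp only [hamP_X_X, hamP_smul, Derivation.smul_apply, Derivation.map_smul, smul_smul]
        rw [show i + j + l = i + (j + l) from add_assoc i j l,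
          show j + (i + l) = i + (j + l) from add_left_comm j i l, ← add_smul]
        congr 1
        push_cast
        ring
      simp only [Derivation.leibniz, map_add, smul_eq_mul, hp, hl]
      ring
  have hX : ∀ (i : ℕ+) (g h : MvPolynomial ℕ+ k),
      hamP k (.X i) (hamP k g h) = hamP k (hamP k (.X i) g) h + hamP k g (hamP k (.X i) h) := by
    intro i g h
    refine flip _ _ _ ?_
    induction g using MvPolynomial.induction_on with
    | C c => exact hC c _ _
    | add p q hp hq => simp only [hamP_add, Derivation.add_apply, map_add, hp, hq]; ring
    | mul_X p j hp => exact step _ _ _ _ hp (hXX j i h)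
  induction f using MvPolynomial.induction_on with
  | C c => exact hC c _ _
  | add p q hp hq => simp only [hamP_add, Derivation.add_apply, map_add, hp, hq]; ring
  | mul_X p i hp => exact step _ _ _ _ hp (hX i g h)

/-- The Poisson bracket on `S(W₊)`: the unique biderivation extending the Lie bracket,
`{f, g} = ∑_{i,j} (∂f/∂x_i) (∂g/∂x_j) (j - i) x_{i+j}`. -/
instance : PoissonAlgebra k (SymW k) where
  pb := LinearMap.mk₂ k
    (fun f g => (equivPoly k).symm (hamP k (equivPoly k f) (equivPoly k g)))
    (by intro f f' g; simp only [map_add, hamP_add, Derivation.add_apply])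
    (by intro c f g; simp only [map_smul, hamP_smul, Derivation.smul_apply])
    (by intro f g g'; simp only [map_add])
    (by intro c f g; rw [map_smul, Derivation.map_smul, map_smul])
  pb_self f := by simp only [LinearMap.mk₂_apply, hamP_self, map_zero]
  pb_jacobi f g h := by
    simp only [LinearMap.mk₂_apply, AlgEquiv.apply_symm_apply]
    rw [← map_add, ← map_add, hamP_jacobi, hamP_swap k (equivPoly k h) (hamP k _ _),
      hamP_swap k (equivPoly k h) (equivPoly k f), map_neg]
    simp
  pb_mul f g h := by
    simp only [LinearMap.mk₂_apply]
    rw [map_mul, Derivation.leibniz]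
    simp only [smul_eq_mul, map_add, map_mul, AlgEquiv.symm_apply_apply]
    ring

theorem pb_x (i j : ℕ+) : PoissonAlgebra.pb (k := k) (x k i) (x k j) =
    (((j : ℕ) : k) - ((i : ℕ) : k)) • x k (i + j) := by
  change (equivPoly k).symm (hamP k (equivPoly k (x k i)) (equivPoly k (x k j))) = _
  have h : ∀ i, equivPoly k (x k i) = MvPolynomial.X i :=
    fun i => SymmetricAlgebra.equivMvPolynomial_ι_apply (WittPos.basis k) i
  rw [h, h, hamP_X_X, map_smul, ← h, AlgEquiv.symm_apply_apply]

end SymW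

/-! ### The enveloping algebra, its filtrations, and associated graded ideals -/

/-- The universal enveloping algebra `U(W₊)`. -/
abbrev UW (k : Type*) [Field k] : Type _ := UniversalEnvelopingAlgebra k (WittPos k)

section Gr

variable (k : Type*) [Field k]

/-- `e_i` as an element of `U(W₊)`. -/
def UW.e (i : ℕ+) : UW k := UniversalEnvelopingAlgebra.ι k (WittPos.e k i)

/-- Given weights `w i` of the letters `i ≥ 1`, the span in the free algebra of all words
`i_1 i_2 ⋯ i_r` whose weight `w i_1 + ⋯ + w i_r` lies in `s`. -/
def wordSpan (w : ℕ+ → ℕ) (s : Set ℕ) : Submodule k (FreeAlgebra k ℕ+) :=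
  Submodule.span k
    ((fun l : List ℕ+ => (l.map (FreeAlgebra.ι k)).prod) '' {l | (l.map w).sum ∈ s})

/-- Evaluation `t ↦ t(e_1, e_2, …)` of noncommutative polynomials in `U(W₊)`. -/
def evalU : FreeAlgebra k ℕ+ →ₐ[k] UW k := FreeAlgebra.lift k (UW.e k)

/-- Evaluation `t ↦ t(x_1, x_2, …)` of noncommutative polynomials in `S(W₊)`. -/
def evalS : FreeAlgebra k ℕ+ →ₐ[k] SymW k := FreeAlgebra.lift k (SymW.x k)

/-- For the filtration of `U(W₊)` in which `e_i` has weight `w i`, the span of all products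
`e_{i_1} ⋯ e_{i_r}` of weight `< n`. -/
def filtLT (w : ℕ+ → ℕ) (n : ℕ) : Submodule k (UW k) :=
  (wordSpan k w (Set.Iio n)).map (evalU k).toLinearMap

variable {k}

/-- The associated graded space of `J ⊆ U(W₊)` for the filtration given by the weights `w`.
The algebra `B` is the associated graded algebra of `U(W₊)`, and for a noncommutative polynomial
`t`, homogeneous of weight `n`, `φ t ∈ B` is the class of `t(e_1, e_2, …)` in degree `n`.
Thus `gr J` is spanned by the leading terms of the elements `f ∈ J`: if
`f = t(e_1, e_2, …) + (terms of weight < n)` then `φ t` is the degree `n` leading term of `f`.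
(For `B = S(W₊)` this is well defined, and is the usual principal symbol, by the
Poincaré–Birkhoff–Witt theorem.) -/
def grSpan (w : ℕ+ → ℕ) {B : Type*} [Ring B] [Algebra k B] (φ : FreeAlgebra k ℕ+ →ₐ[k] B)
    (J : Ideal (UW k)) : Submodule k B :=
  Submodule.span k
    {b | ∃ n, ∃ t ∈ wordSpan k w {n}, φ t = b ∧ ∃ f ∈ J, f - evalU k t ∈ filtLT k w n}

theorem wordSpan_mul_left (w : ℕ+ → ℕ) {s s' : Set ℕ} (j : ℕ+) (h : ∀ a ∈ s, w j + a ∈ s')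
    {t : FreeAlgebra k ℕ+} (ht : t ∈ wordSpan k w s) :
    FreeAlgebra.ι k j * t ∈ wordSpan k w s' := by
  induction ht using Submodule.span_induction with
  | mem y hy =>
    obtain ⟨l, hl, rfl⟩ := hy
    exact Submodule.subset_span ⟨j :: l, by simpa using h _ hl, by simp⟩
  | zero => simp
  | add y z _ _ hy hz => rw [mul_add]; exact add_mem hy hz
  | smul c y _ hy => rw [mul_smul_comm]; exact Submodule.smul_mem _ _ hy

theorem wordSpan_mul_right (w : ℕ+ → ℕ) {s s' : Set ℕ} (j : ℕ+) (h : ∀ a ∈ s, a + w j ∈ s')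
    {t : FreeAlgebra k ℕ+} (ht : t ∈ wordSpan k w s) :
    t * FreeAlgebra.ι k j ∈ wordSpan k w s' := by
  induction ht using Submodule.span_induction with
  | mem y hy =>
    obtain ⟨l, hl, rfl⟩ := hy
    exact Submodule.subset_span ⟨l ++ [j], by simpa using h _ hl, by simp⟩
  | zero => simp
  | add y z _ _ hy hz => rw [add_mul]; exact add_mem hy hz
  | smul c y _ hy => rw [smul_mul_assoc]; exact Submodule.smul_mem _ _ hy

variable (w : ℕ+ → ℕ) {B : Type*} [Ring B] [Algebra k B] (φ : FreeAlgebra k ℕ+ →ₐ[k] B)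
  (J : Ideal (UW k))

theorem grSpan_mul_left (a : FreeAlgebra k ℕ+) {b : B} (hb : b ∈ grSpan w φ J) :
    φ a * b ∈ grSpan w φ J := by
  induction a using FreeAlgebra.induction generalizing b with
  | grade0 c =>
    rw [AlgHom.commutes, ← Algebra.smul_def]
    exact Submodule.smul_mem _ _ hb
  | mul a a' ha ha' => rw [map_mul, mul_assoc]; exact ha (ha' hb)
  | add a a' ha ha' => rw [map_add, add_mul]; exact add_mem (ha hb) (ha' hb)
  | grade1 j =>
    induction hb using Submodule.span_induction with
    | mem y hy =>
      obtain ⟨n, t, ht, rfl, f, hf, v, hv, hvf⟩ := hy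
      refine Submodule.subset_span ⟨w j + n, FreeAlgebra.ι k j * t,
        wordSpan_mul_left w j (by simp) ht, by simp, UW.e k j * f, J.mul_mem_left _ hf,
        FreeAlgebra.ι k j * v, wordSpan_mul_left w j (by simp) hv, ?_⟩
      change evalU k v = _ at hvf
      change evalU k _ = _
      rw [map_mul, map_mul, hvf, mul_sub]
      simp [evalU]
    | zero => simp
    | add y z _ _ hy hz => rw [mul_add]; exact add_mem hy hz
    | smul c y _ hy => rw [mul_smul_comm]; exact Submodule.smul_mem _ _ hy

theorem grSpan_mul_right [J.IsTwoSided] (a : FreeAlgebra k ℕ+) {b : B} (hb : b ∈ grSpan w φ J) :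
    b * φ a ∈ grSpan w φ J := by
  induction a using FreeAlgebra.induction generalizing b with
  | grade0 c =>
    rw [AlgHom.commutes, ← Algebra.commutes, ← Algebra.smul_def]
    exact Submodule.smul_mem _ _ hb
  | mul a a' ha ha' => rw [map_mul, ← mul_assoc]; exact ha' (ha hb)
  | add a a' ha ha' => rw [map_add, mul_add]; exact add_mem (ha hb) (ha' hb)
  | grade1 j =>
    induction hb using Submodule.span_induction with
    | mem y hy =>
      obtain ⟨n, t, ht, rfl, f, hf, v, hv, hvf⟩ := hy
      refine Submodule.subset_span ⟨n + w j, t * FreeAlgebra.ι k j,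
        wordSpan_mul_right w j (by simp) ht, by simp, f * UW.e k j, J.mul_mem_right _ hf,
        v * FreeAlgebra.ι k j, wordSpan_mul_right w j (by simp) hv, ?_⟩
      change evalU k v = _ at hvf
      change evalU k _ = _
      rw [map_mul, map_mul, hvf, sub_mul]
      simp [evalU]
    | zero => simp
    | add y z _ _ hy hz => rw [add_mul]; exact add_mem hy hz
    | smul c y _ hy => rw [smul_mul_assoc]; exact Submodule.smul_mem _ _ hy

variable {φ} in
/-- `gr J` as an ideal. -/
def grIdeal (hφ : Function.Surjective φ) : Ideal B where
  carrier := grSpan w φ J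
  add_mem' := add_mem
  zero_mem' := zero_mem _
  smul_mem' c b hb := by
    obtain ⟨a, rfl⟩ := hφ c
    exact grSpan_mul_left w φ J a hb

variable {φ} in
instance grIdeal_isTwoSided [J.IsTwoSided] (hφ : Function.Surjective φ) :
    (grIdeal w J hφ).IsTwoSided where
  mul_mem_of_left {b} c hb := by
    obtain ⟨a, rfl⟩ := hφ c
    exact grSpan_mul_right w φ J a hb

variable (k) in
theorem evalU_surjective : Function.Surjective (evalU k) := by
  have hι : ∀ y : WittPos k, UniversalEnvelopingAlgebra.ι k y ∈ (evalU k).range := by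
    intro y
    induction y using WittPos.e_induction with
    | mem i => exact ⟨FreeAlgebra.ι k i, by simp [evalU, UW.e]⟩
    | zero => simp
    | add x y hx hy => rw [map_add]; exact add_mem hx hy
    | smul c x hx => rw [map_smul]; exact Subalgebra.smul_mem _ hx c
  intro u
  change u ∈ (evalU k).range
  obtain ⟨t, rfl⟩ : ∃ t, UniversalEnvelopingAlgebra.mkAlgHom k (WittPos k) t = u :=
    Quotient.mk_surjective u
  induction t using TensorAlgebra.induction with
  | algebraMap r => rw [AlgHom.commutes]; exact Subalgebra.algebraMap_mem _ r
  | ι y => exact hι y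
  | mul a b ha hb => rw [map_mul]; exact mul_mem ha hb
  | add a b ha hb => rw [map_add]; exact add_mem ha hb

variable (k) in
theorem evalS_surjective : Function.Surjective (evalS k) := by
  have hι : ∀ y : WittPos k, SymmetricAlgebra.ι k _ y ∈ (evalS k).range := by
    intro y
    induction y using WittPos.e_induction with
    | mem i => exact ⟨FreeAlgebra.ι k i, by simp [evalS, SymW.x]⟩
    | zero => rw [map_zero]; exact zero_mem _
    | add x y hx hy => rw [map_add]; exact add_mem hx hy
    | smul c x hx => rw [map_smul]; exact Subalgebra.smul_mem _ hx c
  intro s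
  change s ∈ (evalS k).range
  induction s using SymmetricAlgebra.induction with
  | algebraMap r => exact Subalgebra.algebraMap_mem _ r
  | ι y => exact hι y
  | mul a b ha hb => exact mul_mem ha hb
  | add a b ha hb => exact add_mem ha hb

/-- `gr_d(J) ◁ U(W₊)`: the ideal spanned by the top-degree components of the elements of `J`, for
the grading of `U(W₊)` with `d(e_i) = i` (so that `gr_d U(W₊) = U(W₊)`). -/
def grD (J : Ideal (UW k)) : Ideal (UW k) :=
  grIdeal (fun i => (i : ℕ)) J (evalU_surjective k)

instance (J : Ideal (UW k)) [J.IsTwoSided] : (grD J).IsTwoSided :=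
  inferInstanceAs (grIdeal _ J (evalU_surjective k)).IsTwoSided

/-- `gr_o(I) ◁ S(W₊) = gr_o U(W₊)`: the ideal of leading symbols of the elements of `I`, for the
order filtration of `U(W₊)`, with `o(e_i) = 1`. -/
def grO (I : Ideal (UW k)) : Ideal (SymW k) :=
  grIdeal (fun _ => 1) I (evalS_surjective k)

/-- `gr_do(I) ◁ S(W₊) = gr_do U(W₊)`: the ideal of leading symbols of the elements of `I`, for the
degree-order filtration of `U(W₊)`, with `do(e_i) = i + 1`. -/
def grDO (I : Ideal (UW k)) : Ideal (SymW k) :=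
  grIdeal (fun i => (i : ℕ) + 1) I (evalS_surjective k)

theorem UW.e_comm (i j : ℕ+) : UW.e k i * UW.e k j - UW.e k j * UW.e k i =
    (((j : ℕ) : k) - ((i : ℕ) : k)) • UW.e k (i + j) := by
  let _ : LieRing (UW k) := LieRing.ofAssociativeRing
  unfold UW.e
  rw [← map_smul, ← WittPos.lie_e, LieHom.map_lie, LieRing.of_associative_ring_bracket]

theorem PoissonAlgebra.pb_mul_left {A : Type*} [CommRing A] [Algebra k A] [PoissonAlgebra k A]
    (a b c : A) : PoissonAlgebra.pb (k := k) (a * b) c =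
      a * PoissonAlgebra.pb (k := k) b c + b * PoissonAlgebra.pb (k := k) a c := by
  rw [PoissonAlgebra.pb_swap, PoissonAlgebra.pb_mul, PoissonAlgebra.pb_swap b c,
    PoissonAlgebra.pb_swap a c]
  ring

theorem PoissonAlgebra.pb_one {A : Type*} [CommRing A] [Algebra k A] [PoissonAlgebra k A]
    (a : A) : PoissonAlgebra.pb (k := k) a 1 = 0 := by
  simpa using PoissonAlgebra.pb_mul (k := k) a 1 1

/-- The adjoint action of `e_j` lifts to words, preserving their length, compatibly with the
commutator in `U(W₊)` and the Poisson bracket in `S(W₊)`. -/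
theorem exists_ad_word (j : ℕ+) (l : List ℕ+) :
    ∃ t' ∈ wordSpan k (fun _ => 1) {l.length},
      evalU k t' = UW.e k j * evalU k (l.map (FreeAlgebra.ι k)).prod
        - evalU k (l.map (FreeAlgebra.ι k)).prod * UW.e k j ∧
      evalS k t' = PoissonAlgebra.pb (k := k) (SymW.x k j)
        (evalS k (l.map (FreeAlgebra.ι k)).prod) := by
  induction l with
  | nil => exact ⟨0, zero_mem _, by simp, by simp [PoissonAlgebra.pb_one]⟩
  | cons i l ih =>
    obtain ⟨t, ht, hU, hS⟩ := ih
    have hl : (l.map (FreeAlgebra.ι k)).prod ∈ wordSpan k (fun _ => 1) {l.length} :=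
      Submodule.subset_span ⟨l, by simp, rfl⟩
    refine ⟨((((i : ℕ) : k) - ((j : ℕ) : k)) •
        (FreeAlgebra.ι k (j + i) * (l.map (FreeAlgebra.ι k)).prod)) + FreeAlgebra.ι k i * t,
      add_mem (Submodule.smul_mem _ _ (wordSpan_mul_left _ _ (by simp [add_comm]) hl))
        (wordSpan_mul_left _ _ (by simp [add_comm]) ht), ?_, ?_⟩
    · have hi : ∀ i, evalU k (FreeAlgebra.ι k i) = UW.e k i := fun i => by simp [evalU]
      simp only [List.map_cons, List.prod_cons, map_add, map_smul, map_mul, hi, hU]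
      rw [← smul_mul_assoc, ← UW.e_comm]
      noncomm_ring
    · have hi : ∀ i, evalS k (FreeAlgebra.ι k i) = SymW.x k i := fun i => by simp [evalS]
      simp only [List.map_cons, List.prod_cons, map_add, map_smul, map_mul, hi, hS]
      rw [← smul_mul_assoc, ← SymW.pb_x, PoissonAlgebra.pb_mul]

theorem exists_ad (j : ℕ+) (s : Set ℕ) {t : FreeAlgebra k ℕ+}
    (ht : t ∈ wordSpan k (fun _ => 1) s) : ∃ t' ∈ wordSpan k (fun _ => 1) s,
      evalU k t' = UW.e k j * evalU k t - evalU k t * UW.e k j ∧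
      evalS k t' = PoissonAlgebra.pb (k := k) (SymW.x k j) (evalS k t) := by
  induction ht using Submodule.span_induction with
  | mem y hy =>
    obtain ⟨l, hl, rfl⟩ := hy
    obtain ⟨t', ht', h⟩ := exists_ad_word (k := k) j l
    refine ⟨t', Submodule.span_mono (Set.image_mono ?_) ht', h⟩
    intro l' hl'
    simp only [List.map_const', List.sum_replicate, smul_eq_mul, mul_one, Set.mem_ofPred_eq,
      Set.mem_singleton_iff] at hl hl' ⊢
    rwa [hl']
  | zero => exact ⟨0, zero_mem _, by simp, by simp⟩
  | add y z _ _ hy hz =>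
    obtain ⟨y', hy', hU, hS⟩ := hy
    obtain ⟨z', hz', hU', hS'⟩ := hz
    refine ⟨y' + z', add_mem hy' hz', ?_, ?_⟩
    · simp only [map_add, hU, hU', mul_add, add_mul]; abel
    · simp only [map_add, hS, hS']
  | smul c y _ hy =>
    obtain ⟨y', hy', hU, hS⟩ := hy
    refine ⟨c • y', Submodule.smul_mem _ _ hy', ?_, ?_⟩
    · simp only [map_smul, hU, mul_smul_comm, smul_mul_assoc, smul_sub]
    · simp only [map_smul, hS]

/-- `gr_o(I)` is a Poisson ideal of `S(W₊)`. -/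
instance grO_isPoisson (I : Ideal (UW k)) [I.IsTwoSided] : IsPoissonIdeal k (grO I) where
  pb_mem a b hb := by
    obtain ⟨a, rfl⟩ := evalS_surjective k a
    induction a using FreeAlgebra.induction with
    | grade0 c =>
      rw [AlgHom.commutes, PoissonAlgebra.pb_swap, Algebra.algebraMap_eq_smul_one, map_smul,
        PoissonAlgebra.pb_one, smul_zero, neg_zero]
      exact zero_mem _
    | mul a a' ha ha' =>
      rw [map_mul, PoissonAlgebra.pb_mul_left]
      exact add_mem (Ideal.mul_mem_left _ _ ha') (Ideal.mul_mem_left _ _ ha)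
    | add a a' ha ha' =>
      rw [map_add, map_add, LinearMap.add_apply]
      exact add_mem ha ha'
    | grade1 j =>
      have hj : evalS k (FreeAlgebra.ι k j) = SymW.x k j := by simp [evalS]
      rw [hj]
      change b ∈ grSpan _ (evalS k) I at hb
      change _ ∈ grSpan _ (evalS k) I
      induction hb using Submodule.span_induction with
      | mem y hy =>
        obtain ⟨n, t, ht, rfl, f, hf, v, hv, hvf⟩ := hy
        obtain ⟨t', ht', hU, hS⟩ := exists_ad j _ ht
        obtain ⟨v', hv', hU', -⟩ := exists_ad j _ hv
        refine Submodule.subset_span ⟨n, t', ht', hS, UW.e k j * f - f * UW.e k j,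
          sub_mem (I.mul_mem_left _ hf) (I.mul_mem_right _ hf), v', hv', ?_⟩
        change evalU k v = _ at hvf
        change evalU k v' = _
        rw [hU', hU, hvf]
        noncomm_ring
      | zero => rw [map_zero]; exact zero_mem _
      | add y z _ _ hy hz => rw [map_add]; exact add_mem hy hz
      | smul c y _ hy => rw [map_smul]; exact Submodule.smul_mem _ _ hy

end Gr

end

/-! ### Growth exponents -/

/-! All three dimensions are growth exponents of weight filtrations. Give each letter `i` a weight
`w i ≥ i`; then the span of words of weight at most `n` is finite-dimensional. Every
finite-dimensional subspace lies in some piece of weight at most `m`, so its powers grow no faster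
than the filtration, up to rescaling `n`. Conversely, in characteristic zero `[e_1, e_i] = (i - 1)
e_{i+1}` produces every `e_i` from `e_1` and `e_2` with fewer than `i` brackets when `i ≥ 2`, so the
powers of the span of `e_1, e_2` catch up with the filtration. The Poisson case is the same with
`{x_1, x_i}`. Hence `GKdim_eq_growthExponent_weightLE` and `PGKdim_eq_growthExponent_weightLE`,
where the choice of `w` is free; for the Poisson bracket, `w` must also be subadditive.

It remains to compare dimensions of filtered pieces. By `finrank_map_wordSpan_eq` it suffices that
in both quotients the same homogeneous elements become equal to something of lower weight. For `J`
against `gr_d(J)` the weight is the degree `d`, and this is what being a leading component means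
(`exists_sub_mem_iff_grD`). For `I = gr_d(J)` against its symbols, the order filtration has
infinite-dimensional pieces, while commutators do not drop in degree. The degree-order weight `i +
1` avoids both defects, and `exists_sub_mem_iff_grSpan_evalS` applies.

This yields `gr_do(I)`, which equals `gr_o(I)` because `I` is graded by degree: on words of one
fixed degree, order and degree-order differ by a constant (`grSpan_evalS_le_of_homogeneous`).

The injectivity half of the Poincaré–Birkhoff–Witt theorem is never needed. The space `grSpan`
contains by construction the image of every homogeneous noncommutative polynomial whose value in
`U(W₊)` drops in weight. Only the easy half enters: reordering a word changes its value by lower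
terms. -/

/-- A linear rescaling of the argument is absorbed by the constant `m` built into `GrowthLE`. -/
theorem growthExponent_le_of_le {f g : ℕ → ℕ} (m : ℕ) (hm : 0 < m) (h : ∀ n, f n ≤ g (m * n)) :
    growthExponent f ≤ growthExponent g := by
  refine le_iInf₂ fun γ ⟨c, m', hc⟩ => iInf₂_le γ ⟨c, m' * m, ?_⟩
  have ht : Filter.Tendsto (fun n : ℕ => m * n) Filter.atTop Filter.atTop :=
    Filter.tendsto_id.const_mul_atTop' hm
  filter_upwards [ht.eventually hc] with n hn
  refine le_trans (by exact_mod_cast h n) (hn.trans_eq ?_)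
  rw [mul_assoc]

/-! ### Words in the free algebra -/

section Words

variable {k : Type*} [Field k]

variable (k) in
/-- The word `i_1 ⋯ i_r` as an element of the free algebra. -/
abbrev word (l : List ℕ+) : FreeAlgebra k ℕ+ := (l.map (FreeAlgebra.ι k)).prod

theorem word_nil : word k [] = 1 := rfl

theorem word_cons (i : ℕ+) (l : List ℕ+) : word k (i :: l) = FreeAlgebra.ι k i * word k l := by
  simp [word]

theorem word_singleton (i : ℕ+) : word k [i] = FreeAlgebra.ι k i := by
  simp [word]

theorem word_mem_wordSpan {w : ℕ+ → ℕ} {s : Set ℕ} {l : List ℕ+} (h : (l.map w).sum ∈ s) :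
    word k l ∈ wordSpan k w s :=
  Submodule.subset_span ⟨l, h, rfl⟩

theorem wordSpan_induction {w : ℕ+ → ℕ} {s : Set ℕ} {p : ∀ t, t ∈ wordSpan k w s → Prop}
    (word : ∀ (l : List ℕ+) (hl : (l.map w).sum ∈ s), p (word k l) (word_mem_wordSpan hl))
    (zero : p 0 (zero_mem _))
    (add : ∀ x y hx hy, p x hx → p y hy → p (x + y) (add_mem hx hy))
    (smul : ∀ (c : k) x hx, p x hx → p (c • x) (Submodule.smul_mem _ c hx))
    {t : FreeAlgebra k ℕ+} (ht : t ∈ wordSpan k w s) : p t ht := by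
  induction ht using Submodule.span_induction with
  | mem y hy => obtain ⟨l, hl, rfl⟩ := hy; exact word l hl
  | zero => exact zero
  | add y z hy hz ihy ihz => exact add y z hy hz ihy ihz
  | smul c y hy ihy => exact smul c y hy ihy

theorem wordSpan_mono (w : ℕ+ → ℕ) {s s' : Set ℕ} (h : s ⊆ s') :
    wordSpan k w s ≤ wordSpan k w s' :=
  Submodule.span_mono (Set.image_mono fun _ hl => h hl)

theorem wordSpan_mul (w : ℕ+ → ℕ) {s s' s'' : Set ℕ} (h : ∀ a ∈ s, ∀ b ∈ s', a + b ∈ s'')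
    {t t' : FreeAlgebra k ℕ+} (ht : t ∈ wordSpan k w s) (ht' : t' ∈ wordSpan k w s') :
    t * t' ∈ wordSpan k w s'' := by
  induction ht using wordSpan_induction with
  | zero => simp
  | add x y _ _ hx hy => rw [add_mul]; exact add_mem hx hy
  | smul c x _ hx => rw [smul_mul_assoc]; exact Submodule.smul_mem _ _ hx
  | word l hl =>
    induction ht' using wordSpan_induction with
    | zero => simp
    | add x y _ _ hx hy => rw [mul_add]; exact add_mem hx hy
    | smul c x _ hx => rw [mul_smul_comm]; exact Submodule.smul_mem _ _ hx
    | word l' hl' =>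
      have : word k l * word k l' = word k (l ++ l') := by simp [word]
      rw [this]
      exact word_mem_wordSpan (by simpa using h _ hl _ hl')

theorem wordSpan_union (w : ℕ+ → ℕ) (s s' : Set ℕ) :
    wordSpan k w (s ∪ s') = wordSpan k w s ⊔ wordSpan k w s' := by
  rw [wordSpan, wordSpan, wordSpan, ← Submodule.span_union, ← Set.image_union]
  rfl

theorem mem_wordSpan_univ (w : ℕ+ → ℕ) (t : FreeAlgebra k ℕ+) :
    t ∈ wordSpan k w Set.univ := by
  induction t using FreeAlgebra.induction with
  | grade0 c =>
    rw [Algebra.algebraMap_eq_smul_one]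
    exact Submodule.smul_mem _ _ (word_mem_wordSpan (l := []) (Set.mem_univ _))
  | grade1 i =>
    rw [← word_singleton]
    exact word_mem_wordSpan (Set.mem_univ _)
  | mul a b ha hb => exact wordSpan_mul w (by simp) ha hb
  | add a b ha hb => exact add_mem ha hb

theorem exists_mem_wordSpan_Iic (w : ℕ+ → ℕ) (t : FreeAlgebra k ℕ+) :
    ∃ m, t ∈ wordSpan k w (Set.Iic m) := by
  induction mem_wordSpan_univ w t using wordSpan_induction with
  | zero => exact ⟨0, zero_mem _⟩
  | add x y _ _ hx hy =>
    obtain ⟨m, hm⟩ := hx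
    obtain ⟨n, hn⟩ := hy
    exact ⟨max m n, add_mem (wordSpan_mono w (Set.Iic_subset_Iic.2 (le_max_left _ _)) hm)
      (wordSpan_mono w (Set.Iic_subset_Iic.2 (le_max_right _ _)) hn)⟩
  | smul c x _ hx =>
    obtain ⟨m, hm⟩ := hx
    exact ⟨m, Submodule.smul_mem _ _ hm⟩
  | word l hl => exact ⟨_, word_mem_wordSpan (Set.mem_Iic.2 le_rfl)⟩

/-- The bound `i ≤ w i` leaves finitely many choices for the first letter, and also makes its weight
positive, so that deleting it lowers the bound. The order weight, constantly `1`, fails the first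
requirement. -/
theorem finite_setOf_weight_lt {w : ℕ+ → ℕ} (hw : ∀ i : ℕ+, (i : ℕ) ≤ w i) (n : ℕ) :
    {l : List ℕ+ | (l.map w).sum < n}.Finite := by
  induction n with
  | zero => simp
  | succ n ih =>
    have hfin : {i : ℕ+ | (i : ℕ) ≤ n}.Finite := by
      refine (Set.finite_Iic (⟨n + 1, n.succ_pos⟩ : ℕ+)).subset fun i hi => ?_
      have hi' : (i : ℕ) ≤ n := hi
      exact PNat.coe_le_coe _ _ |>.1 (hi'.trans n.le_succ)
    refine ((Set.finite_singleton []).union (hfin.image2 List.cons ih)).subset ?_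
    rintro (_ | ⟨i, l⟩) hl
    · exact Or.inl rfl
    · have hl' : w i + (l.map w).sum < n + 1 := by simpa using hl
      have h1 := hw i
      have h2 := i.pos
      refine Or.inr ⟨i, ?_, l, ?_, rfl⟩
      · change (i : ℕ) ≤ n
        omega
      · change (l.map w).sum < n
        omega

theorem wordSpan_finite {w : ℕ+ → ℕ} (hw : ∀ i : ℕ+, (i : ℕ) ≤ w i) {s : Set ℕ} {n : ℕ}
    (hs : s ⊆ Set.Iio n) : FiniteDimensional k (wordSpan k w s) :=
  FiniteDimensional.span_of_finite k
    (((finite_setOf_weight_lt hw n).subset fun _ hl => hs hl).image _)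

end Words

/-! ### Dimensions of filtered pieces -/

section Dimension

variable {k : Type*} [Field k]

theorem finrank_sup_eq_add_finrank_map_mkQ {Q : Type*} [AddCommGroup Q] [Module k Q]
    (A B : Submodule k Q) [FiniteDimensional k A] [FiniteDimensional k B] :
    Module.finrank k ↥(A ⊔ B) = Module.finrank k A + Module.finrank k (B.map A.mkQ) := by
  have h := LinearMap.finrank_range_add_finrank_ker (A.mkQ.domRestrict (A ⊔ B))
  have hr : LinearMap.range (A.mkQ.domRestrict (A ⊔ B)) = B.map A.mkQ := by
    rw [LinearMap.range_domRestrict, Submodule.map_sup, Submodule.mkQ_map_self, bot_sup_eq]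
  have hk : LinearMap.ker (A.mkQ.domRestrict (A ⊔ B)) = A.comap (A ⊔ B).subtype := by
    rw [LinearMap.ker_domRestrict, Submodule.ker_mkQ]
  rw [hr, hk, (Submodule.comapSubtypeEquivOfLe (le_sup_left : A ≤ A ⊔ B)).finrank_eq] at h
  omega

theorem finrank_map_add_finrank_ker_domRestrict {P Q : Type*} [AddCommGroup P] [Module k P]
    [AddCommGroup Q] [Module k Q] (f : P →ₗ[k] Q) (A : Submodule k P) [FiniteDimensional k A] :
    Module.finrank k (A.map f) + Module.finrank k (LinearMap.ker (f.domRestrict A)) =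
      Module.finrank k A := by
  rw [← LinearMap.range_domRestrict]
  exact LinearMap.finrank_range_add_finrank_ker _

/-- Two images of the free algebra, filtered by weight, have pieces of equal dimension as soon as
homogeneous elements drop in weight simultaneously in both. -/
theorem finrank_map_wordSpan_eq {Q Q' : Type*} [AddCommGroup Q] [Module k Q] [AddCommGroup Q']
    [Module k Q'] {w : ℕ+ → ℕ} (hw : ∀ i : ℕ+, (i : ℕ) ≤ w i) (ψ : FreeAlgebra k ℕ+ →ₗ[k] Q)
    (ψ' : FreeAlgebra k ℕ+ →ₗ[k] Q')
    (h : ∀ m, ∀ t ∈ wordSpan k w {m}, ψ t ∈ (wordSpan k w (Set.Iio m)).map ψ ↔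
      ψ' t ∈ (wordSpan k w (Set.Iio m)).map ψ') (n : ℕ) :
    Module.finrank k ((wordSpan k w (Set.Iio n)).map ψ) =
      Module.finrank k ((wordSpan k w (Set.Iio n)).map ψ') := by
  induction n with
  | zero =>
    have : wordSpan k w (Set.Iio 0) = ⊥ := by
      rw [wordSpan, Submodule.span_eq_bot]
      rintro _ ⟨l, hl, -⟩
      exact absurd hl (Nat.not_lt_zero _)
    rw [this, Submodule.map_bot, Submodule.map_bot, finrank_bot, finrank_bot]
  | succ n ih =>
    have hfin := wordSpan_finite (k := k) hw (Set.Subset.refl (Set.Iio n))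
    have hfin' := wordSpan_finite (k := k) hw (s := {n}) (n := n + 1) (by simp)
    have hsucc : wordSpan k w (Set.Iio (n + 1)) =
        wordSpan k w (Set.Iio n) ⊔ wordSpan k w {n} := by
      rw [← wordSpan_union]
      congr 1
      ext a
      simp only [Set.mem_Iio, Set.mem_union, Set.mem_singleton_iff]
      omega
    rw [hsucc, Submodule.map_sup, Submodule.map_sup, finrank_sup_eq_add_finrank_map_mkQ,
      finrank_sup_eq_add_finrank_map_mkQ, ih, ← Submodule.map_comp, ← Submodule.map_comp]
    have h1 := finrank_map_add_finrank_ker_domRestrict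
      (((wordSpan k w (Set.Iio n)).map ψ).mkQ ∘ₗ ψ) (wordSpan k w {n})
    have h2 := finrank_map_add_finrank_ker_domRestrict
      (((wordSpan k w (Set.Iio n)).map ψ').mkQ ∘ₗ ψ') (wordSpan k w {n})
    -- The weight-`n` graded pieces of both images are quotients of the same space `wordSpan k w
    -- {n}`; the hypothesis says that the two kernels coincide.
    have hker : LinearMap.ker
          ((((wordSpan k w (Set.Iio n)).map ψ).mkQ ∘ₗ ψ).domRestrict (wordSpan k w {n})) =
        LinearMap.ker
          ((((wordSpan k w (Set.Iio n)).map ψ').mkQ ∘ₗ ψ').domRestrict (wordSpan k w {n})) := by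
      ext ⟨t, ht⟩
      simp only [LinearMap.mem_ker, LinearMap.domRestrict_apply, LinearMap.comp_apply,
        Submodule.mkQ_apply, Submodule.Quotient.mk_eq_zero]
      exact h n t ht
    rw [hker] at h1
    omega

end Dimension

/-! ### Dimensions in terms of weight filtrations -/

section WeightFiltration

variable {k : Type*} [Field k]

/-- The piece of weight `≤ n` of the weight filtration on an image of the free algebra. -/
noncomputable def weightLE {B : Type*} [Ring B] [Algebra k B] (w : ℕ+ → ℕ) (ψ : FreeAlgebra k ℕ+ →ₐ[k] B)
    (n : ℕ) : Submodule k B :=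
  (wordSpan k w (Set.Iic n)).map ψ.toLinearMap

variable {B : Type*} [Ring B] [Algebra k B] {w : ℕ+ → ℕ} {ψ : FreeAlgebra k ℕ+ →ₐ[k] B}

theorem weightLE_mono {m n : ℕ} (h : m ≤ n) : weightLE w ψ m ≤ weightLE w ψ n :=
  Submodule.map_mono (wordSpan_mono w (Set.Iic_subset_Iic.2 h))

theorem weightLE_mul (m n : ℕ) : weightLE w ψ m * weightLE w ψ n ≤ weightLE w ψ (m + n) := by
  rw [Submodule.mul_le]
  rintro _ ⟨t, ht, rfl⟩ _ ⟨t', ht', rfl⟩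
  exact ⟨t * t', wordSpan_mul w (fun a ha b hb => Set.mem_Iic.2 (add_le_add ha hb)) ht ht', by simp⟩

theorem one_le_weightLE (n : ℕ) : 1 ≤ weightLE w ψ n := by
  rw [Submodule.one_le]
  exact ⟨1, word_mem_wordSpan (l := []) (by simp), by simp⟩

theorem ι_mem_weightLE (i : ℕ+) : ψ (FreeAlgebra.ι k i) ∈ weightLE w ψ (w i) :=
  ⟨_, word_mem_wordSpan (l := [i]) (by simp), by simp [word_singleton]⟩

theorem weightLE_finite (hw : ∀ i : ℕ+, (i : ℕ) ≤ w i) (n : ℕ) :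
    FiniteDimensional k (weightLE w ψ n) := by
  have := wordSpan_finite (k := k) hw (s := Set.Iic n) (n := n + 1)
    fun a ha => Nat.lt_succ_of_le ha
  unfold weightLE
  infer_instance

theorem exists_le_weightLE (hψ : Function.Surjective ψ) {V : Submodule k B} (hV : V.FG) :
    ∃ m, 0 < m ∧ V ≤ weightLE w ψ m := by
  induction V, hV using Submodule.fg_induction with
  | singleton b =>
    obtain ⟨t, rfl⟩ := hψ b
    obtain ⟨m, hm⟩ := exists_mem_wordSpan_Iic w t
    -- One more than needed, so that the rescaling factor is positive.
    refine ⟨m + 1, m.succ_pos, ?_⟩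
    rw [Submodule.span_singleton_le_iff_mem]
    exact weightLE_mono m.le_succ ⟨t, hm, rfl⟩
  | sup A A' _ _ hA hA' =>
    obtain ⟨m, h0, hm⟩ := hA
    obtain ⟨n, -, hn⟩ := hA'
    exact ⟨m + n, by omega, sup_le (hm.trans (weightLE_mono (by omega)))
      (hn.trans (weightLE_mono (by omega)))⟩

theorem pow_le_weightLE {V : Submodule k B} {m : ℕ} (hV : V ≤ weightLE w ψ m) (i : ℕ) :
    V ^ i ≤ weightLE w ψ (m * i) := by
  induction i with
  | zero => simpa using one_le_weightLE (w := w) (ψ := ψ) 0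
  | succ i ih =>
    rw [pow_succ, Nat.mul_succ]
    exact (mul_le_mul' ih hV).trans (weightLE_mul _ _)

/-- If a multiplicative filtration `F` contains the image of the `i`-th generator in degree `i`,
then it contains the pieces of the weight filtration. -/
theorem weightLE_le_of_ι_mem (hw : ∀ i : ℕ+, (i : ℕ) ≤ w i) {F : ℕ → Submodule k B}
    (hF : Monotone F) (h1 : 1 ∈ F 0) (hmul : ∀ m n, F m * F n ≤ F (m + n))
    (hι : ∀ i : ℕ+, ψ (FreeAlgebra.ι k i) ∈ F i) (n : ℕ) : weightLE w ψ n ≤ F n := by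
  have hword : ∀ l : List ℕ+, ψ (word k l) ∈ F (l.map w).sum := by
    intro l
    induction l with
    | nil => simpa [word_nil] using h1
    | cons i l ih =>
      rw [word_cons, map_mul, List.map_cons, List.sum_cons]
      exact hmul _ _ (Submodule.mul_mem_mul (hF (hw i) (hι i)) ih)
  rintro _ ⟨t, ht, rfl⟩
  induction ht using wordSpan_induction with
  | zero => simp
  | add x y _ _ hx hy => rw [map_add]; exact add_mem hx hy
  | smul c x _ hx => rw [map_smul]; exact Submodule.smul_mem _ _ hx
  | word l hl => exact hF hl (hword l)

theorem iSup_range_mono (p : ℕ → Submodule k B) :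
    Monotone fun n => ⨆ i ∈ Finset.range (n + 1), p i := by
  intro m n h
  exact biSup_mono fun i hi => Finset.range_mono (Nat.succ_le_succ h) hi

theorem le_iSup_range (p : ℕ → Submodule k B) {i n : ℕ} (h : i ≤ n) :
    p i ≤ ⨆ i ∈ Finset.range (n + 1), p i :=
  le_biSup p (Finset.mem_range.2 (Nat.lt_succ_of_le h))

theorem iSup_range_mul_le {p : ℕ → Submodule k B} (hp : ∀ m n, p m * p n ≤ p (m + n)) (m n : ℕ) :
    (⨆ i ∈ Finset.range (m + 1), p i) * (⨆ i ∈ Finset.range (n + 1), p i) ≤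
      ⨆ i ∈ Finset.range (m + n + 1), p i := by
  simp only [Submodule.iSup_mul, Submodule.mul_iSup]
  refine iSup₂_le fun i hi => iSup₂_le fun j hj => ?_
  rw [Finset.mem_range] at hi hj
  exact (hp _ _).trans (le_iSup_range p (by omega))

theorem iSup_range_finite {p : ℕ → Submodule k B} (hp : ∀ n, (p n).FG) (n : ℕ) :
    FiniteDimensional k ↥(⨆ i ∈ Finset.range (n + 1), p i) :=
  Module.Finite.iff_fg.2 (Submodule.fg_biSup _ _ fun i _ => hp i)

/-- If the first two generators reach all others by repeatedly applying an operation that raises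
the index by one, then the `i`-th generator lies in the `i`-th piece. -/
theorem mem_iSup_range_of_succ {g : ℕ+ → B} {p : ℕ → Submodule k B} (h1 : g 1 ∈ p 1)
    (h2 : g 2 ∈ p 1) (hsucc : ∀ i : ℕ+, 2 ≤ i → ∀ j, g i ∈ p j → g (i + 1) ∈ p (j + 1)) (i : ℕ+) :
    g i ∈ ⨆ j ∈ Finset.range ((i : ℕ) + 1), p j := by
  -- The chain starts at index 2, since bracketing the first generator with itself gives zero; index
  -- 1 is handled separately.
  have key : ∀ n : ℕ, g ⟨n + 2, by omega⟩ ∈ p (n + 1) := by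
    intro n
    induction n with
    | zero => exact h2
    | succ n ih =>
      exact hsucc (⟨n + 2, by omega⟩ : ℕ+) (Nat.le_add_left 2 n) _ ih
  obtain ⟨n, hn⟩ := i
  match n, hn with
  | 1, _ => exact le_iSup_range p le_rfl h1
  | n + 2, _ => exact le_iSup_range p (by simp) (key n)

/-- This is where characteristic zero enters: the coefficient in `[e_1, e_i] = (i - 1) e_{i+1}` can
be inverted, so `e_1` and `e_2` generate. -/
theorem sub_cast_one_ne_zero [CharZero k] {i : ℕ+} (hi : 2 ≤ i) : ((i : ℕ) : k) - 1 ≠ 0 := by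
  rw [sub_ne_zero]
  have : (2 : ℕ) ≤ i := by exact_mod_cast hi
  exact_mod_cast (by omega : (i : ℕ) ≠ 1)

/-- The Gelfand–Kirillov dimension of a quotient of `U(W₊)` is the growth exponent of its weight
filtration. -/
theorem GKdim_eq_growthExponent_weightLE [CharZero k] (hw : ∀ i : ℕ+, (i : ℕ) ≤ w i)
    (hψ : Function.Surjective ψ)
    (hcomm : ∀ i j : ℕ+, ψ (FreeAlgebra.ι k i) * ψ (FreeAlgebra.ι k j) -
      ψ (FreeAlgebra.ι k j) * ψ (FreeAlgebra.ι k i) =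
        (((j : ℕ) : k) - ((i : ℕ) : k)) • ψ (FreeAlgebra.ι k (i + j))) :
    GKdim k B = growthExponent fun n => Module.finrank k (weightLE w ψ n) := by
  refine le_antisymm (iSup₂_le fun V hV => ?_) ?_
  -- Upper bound: `V` sits in weight at most `m`, so products of at most `n` of its elements have
  -- weight at most `m * n`.
  · obtain ⟨m, hm, hVm⟩ := exists_le_weightLE (w := w) hψ hV
    refine growthExponent_le_of_le m hm fun n => ?_
    have := weightLE_finite (ψ := ψ) hw (m * n)
    refine Submodule.finrank_mono (iSup₂_le fun i hi => (pow_le_weightLE hVm i).trans ?_)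
    exact weightLE_mono (Nat.mul_le_mul_left _ (Nat.lt_succ_iff.1 (Finset.mem_range.1 hi)))
  -- Lower bound: for this single `V`, the sum of its powers up to `n` already contains everything
  -- of weight at most `n`.
  · set g : ℕ+ → B := fun i => ψ (FreeAlgebra.ι k i)
    set V : Submodule k B := Submodule.span k {g 1, g 2}
    have hV : V.FG := Submodule.fg_span (by simp)
    have hg1 : g 1 ∈ V := Submodule.subset_span (by simp)
    have hg2 : g 2 ∈ V := Submodule.subset_span (by simp)
    refine le_trans ?_ (le_iSup₂ (f := fun (V : Submodule k B) (_ : V.FG) =>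
      growthExponent (growthFun V)) V hV)
    refine growthExponent_le_of_le 1 one_pos fun n => ?_
    rw [one_mul]
    have := iSup_range_finite (fun n => hV.pow n) n
    refine Submodule.finrank_mono (weightLE_le_of_ι_mem hw (iSup_range_mono _) ?_
      (iSup_range_mul_le fun m n => (pow_add V m n).ge)
      (mem_iSup_range_of_succ (g := g) (by simpa using hg1) (by simpa using hg2) ?_) n)
    · exact le_iSup_range (fun i => V ^ i) le_rfl (by simp [Submodule.one_le.1])
    · intro i hi j hj
      have h := hcomm 1 i
      rw [PNat.one_coe, Nat.cast_one] at h
      rw [add_comm i 1, ← Submodule.smul_mem_iff _ (sub_cast_one_ne_zero (k := k) hi)]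
      change _ • ψ _ ∈ _
      rw [← h]
      refine sub_mem ?_ ?_
      · rw [pow_succ']; exact Submodule.mul_mem_mul hg1 hj
      · rw [pow_succ]; exact Submodule.mul_mem_mul hj hg1

end WeightFiltration

/-! ### Weight filtrations and Poisson growth -/

section PoissonWeightFiltration

variable {k : Type*} [Field k] {A : Type*} [CommRing A] [Algebra k A] [PoissonAlgebra k A]
  {w : ℕ+ → ℕ} {ψ : FreeAlgebra k ℕ+ →ₐ[k] A}

/-- Multiplicativity is not built into the definition, which multiplies or brackets by one element
of `V` at a time. Products with a bracket are handled by the Leibniz rule, `{v, c} b = {v, c b} - c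
{v, b}`. In the last term `c` has index `m` and `{v, b}` index `n + 1`, so the induction on `m` must
keep `n` arbitrary. -/
theorem poissonPow_mul_le (V : Submodule k A) (m n : ℕ) :
    poissonPow V m * poissonPow V n ≤ poissonPow V (m + n) := by
  induction m generalizing n with
  | zero => simp [poissonPow]
  | succ m ih =>
    rw [Submodule.mul_le]
    intro a ha b hb
    have hmul : ∀ v ∈ V, ∀ c ∈ poissonPow V (m + n), v * c ∈ poissonPow V (m + 1 + n) := by
      intro v hv c hc
      rw [Nat.succ_add_eq_add_succ]
      exact Submodule.mem_sup_left (Submodule.mul_mem_mul hv hc)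
    have hpb : ∀ v ∈ V, ∀ c ∈ poissonPow V (m + n),
        PoissonAlgebra.pb (k := k) v c ∈ poissonPow V (m + 1 + n) := by
      intro v hv c hc
      rw [Nat.succ_add_eq_add_succ]
      exact Submodule.mem_sup_right (Submodule.apply_mem_map₂ _ hv hc)
    have hle : poissonPow V (m + 1) ≤
        (poissonPow V (m + 1 + n)).comap (LinearMap.mulRight k b) := by
      refine sup_le (Submodule.mul_le.2 fun v hv c hc => ?_)
        (Submodule.map₂_le.2 fun v hv c hc => ?_)
      · rw [Submodule.mem_comap, LinearMap.mulRight_apply, mul_assoc]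
        exact hmul v hv _ (ih n (Submodule.mul_mem_mul hc hb))
      · rw [Submodule.mem_comap, LinearMap.mulRight_apply]
        have h := PoissonAlgebra.pb_mul (k := k) v c b
        rw [← sub_eq_iff_eq_add] at h
        rw [← h]
        refine sub_mem (hpb v hv _ (ih n (Submodule.mul_mem_mul hc hb))) ?_
        rw [Nat.succ_add_eq_add_succ]
        exact ih (n + 1) (Submodule.mul_mem_mul hc
          (Submodule.mem_sup_right (Submodule.apply_mem_map₂ _ hv hb)))
    exact hle ha

theorem poissonPow_fg {V : Submodule k A} (hV : V.FG) (n : ℕ) : (poissonPow V n).FG := by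
  induction n with
  | zero => rw [poissonPow, Submodule.one_eq_span]; exact Submodule.fg_span_singleton 1
  | succ n ih => exact (hV.mul ih).sup (hV.map₂ _ ih)

/-- On letters this is subadditivity of `w`; the Leibniz rule extends it to words, first in the
second argument (`h1`) and then in the first (`h2`). -/
theorem pb_weightLE (hadd : ∀ i j, w (i + j) ≤ w i + w j)
    (hpb : ∀ i j : ℕ+, PoissonAlgebra.pb (k := k) (ψ (FreeAlgebra.ι k i)) (ψ (FreeAlgebra.ι k j)) =
        (((j : ℕ) : k) - ((i : ℕ) : k)) • ψ (FreeAlgebra.ι k (i + j))) (m n : ℕ) :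
    Submodule.map₂ PoissonAlgebra.pb (weightLE w ψ m) (weightLE w ψ n) ≤ weightLE w ψ (m + n) := by
  have hwd : ∀ l : List ℕ+, ψ (word k l) ∈ weightLE w ψ (l.map w).sum := fun l =>
    ⟨_, word_mem_wordSpan (Set.mem_Iic.2 le_rfl), rfl⟩
  have hcons : ∀ i (l : List ℕ+), ψ (word k (i :: l)) = ψ (FreeAlgebra.ι k i) * ψ (word k l) := by
    simp [word_cons]
  have h1 : ∀ (i : ℕ+) (l : List ℕ+),
      PoissonAlgebra.pb (k := k) (ψ (FreeAlgebra.ι k i)) (ψ (word k l)) ∈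
        weightLE w ψ (w i + (l.map w).sum) := by
    intro i l
    induction l with
    | nil => simp [word_nil, PoissonAlgebra.pb_one]
    | cons j l ih =>
      rw [hcons, PoissonAlgebra.pb_mul, hpb, List.map_cons, List.sum_cons]
      refine add_mem ?_ ?_
      · rw [← add_assoc]
        exact weightLE_mul _ _ (Submodule.mul_mem_mul
          (Submodule.smul_mem _ _ (weightLE_mono (hadd i j) (ι_mem_weightLE _))) (hwd l))
      · rw [add_left_comm]
        exact weightLE_mul _ _ (Submodule.mul_mem_mul (ι_mem_weightLE _) ih)
  have h2 : ∀ l l' : List ℕ+, PoissonAlgebra.pb (k := k) (ψ (word k l)) (ψ (word k l')) ∈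
        weightLE w ψ ((l.map w).sum + (l'.map w).sum) := by
    intro l l'
    induction l with
    | nil =>
      rw [PoissonAlgebra.pb_swap]
      simp [word_nil, PoissonAlgebra.pb_one]
    | cons i l ih =>
      rw [hcons, PoissonAlgebra.pb_mul_left, List.map_cons, List.sum_cons]
      refine add_mem ?_ ?_
      · rw [add_assoc]
        exact weightLE_mul _ _ (Submodule.mul_mem_mul (ι_mem_weightLE _) ih)
      · rw [add_comm (w i), add_assoc]
        exact weightLE_mul _ _ (Submodule.mul_mem_mul (hwd l) (h1 i l'))
  refine Submodule.map₂_le.2 ?_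
  rintro _ ⟨t, ht, rfl⟩ _ ⟨t', ht', rfl⟩
  induction ht using wordSpan_induction with
  | zero => simp
  | add x y _ _ hx hy => rw [map_add, map_add, LinearMap.add_apply]; exact add_mem hx hy
  | smul c x _ hx =>
    rw [map_smul, map_smul, LinearMap.smul_apply]; exact Submodule.smul_mem _ _ hx
  | word l hl =>
    induction ht' using wordSpan_induction with
    | zero => simp
    | add x y _ _ hx hy => rw [map_add, map_add]; exact add_mem hx hy
    | smul c x _ hx => rw [map_smul, map_smul]; exact Submodule.smul_mem _ _ hx
    | word l' hl' => exact weightLE_mono (add_le_add hl hl') (h2 l l')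

/-- The Poisson Gelfand–Kirillov dimension of a Poisson quotient of `S(W₊)` is the growth exponent
of its weight filtration. -/
theorem PGKdim_eq_growthExponent_weightLE [CharZero k] (hw : ∀ i : ℕ+, (i : ℕ) ≤ w i)
    (hadd : ∀ i j, w (i + j) ≤ w i + w j) (hψ : Function.Surjective ψ)
    (hpb : ∀ i j : ℕ+, PoissonAlgebra.pb (k := k) (ψ (FreeAlgebra.ι k i)) (ψ (FreeAlgebra.ι k j)) =
        (((j : ℕ) : k) - ((i : ℕ) : k)) • ψ (FreeAlgebra.ι k (i + j))) :
    PGKdim k A = growthExponent fun n => Module.finrank k (weightLE w ψ n) := by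
  refine le_antisymm (iSup₂_le fun V hV => ?_) ?_
  · obtain ⟨m, hm, hVm⟩ := exists_le_weightLE (w := w) hψ hV
    refine growthExponent_le_of_le m hm fun n => ?_
    have := weightLE_finite (ψ := ψ) hw (m * n)
    -- Each Poisson step, whether a product or a bracket, raises the weight by at most `m`.
    have hpow : ∀ i, poissonPow V i ≤ weightLE w ψ (m * i) := by
      intro i
      induction i with
      | zero => exact one_le_weightLE _
      | succ i ih =>
        rw [Nat.mul_succ, add_comm (m * i)]
        exact sup_le ((mul_le_mul' hVm ih).trans (weightLE_mul _ _))
          ((Submodule.map₂_le_map₂ hVm ih).trans (pb_weightLE hadd hpb _ _))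
    refine Submodule.finrank_mono (iSup₂_le fun i hi => (hpow i).trans ?_)
    exact weightLE_mono (Nat.mul_le_mul_left _ (Nat.lt_succ_iff.1 (Finset.mem_range.1 hi)))
  · set g : ℕ+ → A := fun i => ψ (FreeAlgebra.ι k i)
    set V : Submodule k A := Submodule.span k {g 1, g 2}
    have hV : V.FG := Submodule.fg_span (by simp)
    have hg1 : g 1 ∈ V := Submodule.subset_span (by simp)
    have hg2 : g 2 ∈ V := Submodule.subset_span (by simp)
    have hpow1 : V ≤ poissonPow V 1 := le_sup_of_le_left (by simp [poissonPow])
    refine le_trans ?_ (le_iSup₂ (f := fun (V : Submodule k A) (_ : V.FG) =>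
      growthExponent (poissonGrowthFun V)) V hV)
    refine growthExponent_le_of_le 1 one_pos fun n => ?_
    rw [one_mul]
    have := iSup_range_finite (poissonPow_fg hV) n
    refine Submodule.finrank_mono (weightLE_le_of_ι_mem hw (iSup_range_mono _) ?_
      (iSup_range_mul_le (poissonPow_mul_le V))
      (mem_iSup_range_of_succ (g := g) (hpow1 hg1) (hpow1 hg2) ?_) n)
    · exact le_iSup_range (poissonPow V) le_rfl (Submodule.one_le.1 le_rfl)
    · intro i hi j hj
      have h := hpb 1 i
      rw [PNat.one_coe, Nat.cast_one] at h
      rw [add_comm i 1, ← Submodule.smul_mem_iff _ (sub_cast_one_ne_zero (k := k) hi)]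
      change _ • ψ _ ∈ _
      rw [← h]
      exact Submodule.mem_sup_right (Submodule.apply_mem_map₂ _ hg1 hj)

end PoissonWeightFiltration

/-! ### Homogeneous components -/

section Components

variable {k : Type*} [Field k]

/-- `c m` is the projection onto the component of weight `m` of an image of the free algebra on
which the weight grading is well defined. -/
def IsWeightProj (w : ℕ+ → ℕ) {B : Type*} [Ring B] [Algebra k B] (φ : FreeAlgebra k ℕ+ →ₐ[k] B)
    (c : ℕ → B →ₗ[k] B) : Prop :=
  ∀ (m : ℕ) (l : List ℕ+), c m (φ (word k l)) = if (l.map w).sum = m then φ (word k l) else 0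

/-- A grading is encoded by a homomorphism to polynomials multiplying each homogeneous element by
`X` to the power of its weight; the projections are its coefficients. Thus a grading exists as soon
as the assignment on generators respects the relations of `B`, and no basis of `B` is needed. -/
theorem exists_isWeightProj_of_algHom {w : ℕ+ → ℕ} {B : Type*} [Ring B] [Algebra k B]
    {φ : FreeAlgebra k ℕ+ →ₐ[k] B} (δ : B →ₐ[k] Polynomial B)
    (hδ : ∀ i, δ (φ (FreeAlgebra.ι k i)) = Polynomial.monomial (w i) (φ (FreeAlgebra.ι k i))) :
    ∃ c, IsWeightProj w φ c := by
  have hword : ∀ l : List ℕ+,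
      δ (φ (word k l)) = Polynomial.monomial (l.map w).sum (φ (word k l)) := by
    intro l
    induction l with
    | nil => rw [word_nil, map_one, map_one]; rfl
    | cons i l ih =>
      rw [word_cons, map_mul, map_mul, hδ, ih, Polynomial.monomial_mul_monomial, List.map_cons,
        List.sum_cons]
  refine ⟨fun m =>
    { toFun := fun b => (δ b).coeff m
      map_add' := by simp
      map_smul' := by simp }, fun m l => ?_⟩
  change (δ (φ (word k l))).coeff m = _
  rw [hword, Polynomial.coeff_monomial]

variable (k) in
theorem exists_isWeightProj_freeAlgebra (w : ℕ+ → ℕ) :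
    ∃ c, IsWeightProj w (AlgHom.id k (FreeAlgebra k ℕ+)) c :=
  exists_isWeightProj_of_algHom
    (FreeAlgebra.lift k fun i => Polynomial.monomial (w i) (FreeAlgebra.ι k i)) (by simp)

theorem evalU_ι (i : ℕ+) : evalU k (FreeAlgebra.ι k i) = UW.e k i := by simp [evalU]

theorem evalS_ι (i : ℕ+) : evalS k (FreeAlgebra.ι k i) = SymW.x k i := by simp [evalS]

variable (k) in
theorem exists_isWeightProj_evalS (w : ℕ+ → ℕ) : ∃ c, IsWeightProj w (evalS k) c :=
  exists_isWeightProj_of_algHom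
    (SymmetricAlgebra.lift ((WittPos.basis k).constr k fun i =>
      Polynomial.monomial (w i) (SymW.x k i))) fun i => by
    rw [evalS_ι, SymW.x, SymmetricAlgebra.lift_ι_apply, WittPos.e, Module.Basis.constr_basis]
    rfl

/-! ### The degree grading on the enveloping algebra -/

section UWGrading

attribute [local instance] LieRing.ofAssociativeRing LieAlgebra.ofAssociativeAlgebra

variable (k) in
/-- The Lie homomorphism `e_i ↦ e_i X ^ i` from `W₊` to `U(W₊)[X]`. -/
noncomputable def UW.degreeLieHom : WittPos k →ₗ⁅k⁆ Polynomial (UW k) where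
  toLinearMap := (WittPos.basis k).constr k fun i => Polynomial.monomial (i : ℕ) (UW.e k i)
  map_lie' {x y} := by
    set f : WittPos k →ₗ[k] Polynomial (UW k) :=
      (WittPos.basis k).constr k fun i => Polynomial.monomial (i : ℕ) (UW.e k i)
    have hf : ∀ i, f (WittPos.e k i) = Polynomial.monomial (i : ℕ) (UW.e k i) := fun i =>
      Module.Basis.constr_basis _ _ _ _
    change f ⁅x, y⁆ = ⁅f x, f y⁆
    induction x using WittPos.e_induction with
    | zero => simp
    | smul c x hx => rw [smul_lie, map_smul, map_smul, smul_lie, hx]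
    | add x x' hx hx' => rw [add_lie, map_add, map_add, add_lie, hx, hx']
    | mem i =>
      induction y using WittPos.e_induction with
      | zero => simp
      | smul c x hx =>
        rw [lie_smul, map_smul, map_smul, hx, LieRing.of_associative_ring_bracket,
          LieRing.of_associative_ring_bracket, mul_smul_comm, smul_mul_assoc, smul_sub]
      | add x x' hx hx' => rw [lie_add, map_add, map_add, lie_add, hx, hx']
      | mem j =>
        rw [WittPos.lie_e, map_smul, hf, hf, hf, LieRing.of_associative_ring_bracket,
          Polynomial.monomial_mul_monomial, Polynomial.monomial_mul_monomial,
          add_comm (j : ℕ) (i : ℕ), ← map_sub, UW.e_comm, PNat.add_coe,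
          Polynomial.smul_monomial]

variable (k) in
-- Only the degree is treated here, because the relation `[e_i, e_j] = (j - i) e_{i+j}` is
-- homogeneous for it; in the commutative `S(W₊)` any weight gives a grading.
theorem exists_isWeightProj_evalU : ∃ c, IsWeightProj (fun i => (i : ℕ)) (evalU k) c :=
  exists_isWeightProj_of_algHom
    (UniversalEnvelopingAlgebra.lift k (UW.degreeLieHom k)) fun i => by
    rw [evalU_ι, UW.e, UniversalEnvelopingAlgebra.lift_ι_apply]
    exact Module.Basis.constr_basis _ _ _ _

end UWGrading

namespace IsWeightProj

variable {w : ℕ+ → ℕ} {B : Type*} [Ring B] [Algebra k B] {φ : FreeAlgebra k ℕ+ →ₐ[k] B}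
  {c : ℕ → B →ₗ[k] B}

theorem apply_of_mem (hc : IsWeightProj w φ c) {n : ℕ} {t : FreeAlgebra k ℕ+}
    (ht : t ∈ wordSpan k w {n}) (m : ℕ) : c m (φ t) = if n = m then φ t else 0 := by
  induction ht using wordSpan_induction with
  | zero => simp
  | add x y _ _ hx hy => rw [map_add, map_add, hx, hy]; split_ifs <;> simp
  | smul a x _ hx => rw [map_smul, map_smul, hx, smul_ite, smul_zero]
  | word l hl =>
    obtain rfl : (l.map w).sum = n := hl
    exact hc m l

theorem apply_eq_zero_of_mem_Iio (hc : IsWeightProj w φ c) {m : ℕ} {t : FreeAlgebra k ℕ+}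
    (ht : t ∈ wordSpan k w (Set.Iio m)) : c m (φ t) = 0 := by
  induction ht using wordSpan_induction with
  | zero => simp
  | add x y _ _ hx hy => rw [map_add, map_add, hx, hy, add_zero]
  | smul a x _ hx => rw [map_smul, map_smul, hx, smul_zero]
  | word l hl => rw [hc, if_neg (ne_of_lt hl)]

variable {p : ℕ → FreeAlgebra k ℕ+ →ₗ[k] FreeAlgebra k ℕ+}

/-- Used to replace a representative in the free algebra by its homogeneous component when an
element of `B` is projected. -/
theorem comp_eq (hc : IsWeightProj w φ c) (hp : IsWeightProj w (AlgHom.id k _) p) (m : ℕ)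
    (t : FreeAlgebra k ℕ+) : c m (φ t) = φ (p m t) := by
  induction mem_wordSpan_univ w t using wordSpan_induction with
  | zero => simp
  | add x y _ _ hx hy => simp only [map_add, hx, hy]
  | smul a x _ hx => simp only [map_smul, hx]
  | word l hl =>
    have h := hp m l
    simp only [AlgHom.id_apply] at h
    rw [hc, h]
    split_ifs <;> simp

/-- The projection keeps or kills each word, so the surviving words satisfy both the original
constraint and the prescribed weight `m`. Three weights are allowed in order to pass from one
filtration to another within a fixed degree. -/
theorem mem_wordSpan (hp : IsWeightProj w (AlgHom.id k _) p) {w' w'' : ℕ+ → ℕ} {s s'' : Set ℕ}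
    {m : ℕ} (h : ∀ l : List ℕ+, (l.map w').sum ∈ s → (l.map w).sum = m → (l.map w'').sum ∈ s'')
    {t : FreeAlgebra k ℕ+} (ht : t ∈ wordSpan k w' s) : p m t ∈ wordSpan k w'' s'' := by
  induction ht using wordSpan_induction with
  | zero => simp
  | add x y _ _ hx hy => rw [map_add]; exact add_mem hx hy
  | smul a x _ hx => rw [map_smul]; exact Submodule.smul_mem _ _ hx
  | word l hl =>
    have hl' := hp m l
    simp only [AlgHom.id_apply] at hl'
    rw [hl']
    split_ifs with hm
    · exact word_mem_wordSpan (h l hl hm)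
    · exact zero_mem _

theorem exists_eq_sum (hp : IsWeightProj w (AlgHom.id k _) p) (t : FreeAlgebra k ℕ+) :
    -- The identity is claimed for all large `M` so that the bounds of two summands can be merged.
    ∃ N, ∀ M ≥ N, t = ∑ m ∈ Finset.range M, p m t := by
  induction mem_wordSpan_univ w t using wordSpan_induction with
  | zero => exact ⟨0, by simp⟩
  | add x y _ _ hx hy =>
    obtain ⟨N, hN⟩ := hx
    obtain ⟨N', hN'⟩ := hy
    refine ⟨max N N', fun M hM => ?_⟩
    simp only [map_add, Finset.sum_add_distrib]
    rw [← hN M ((le_max_left _ _).trans hM), ← hN' M ((le_max_right _ _).trans hM)]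
  | smul a x _ hx =>
    obtain ⟨N, hN⟩ := hx
    refine ⟨N, fun M hM => ?_⟩
    simp only [map_smul, ← Finset.smul_sum]
    rw [← hN M hM]
  | word l hl =>
    refine ⟨(l.map w).sum + 1, fun M hM => ?_⟩
    have hl' : ∀ m, p m (word k l) = if (l.map w).sum = m then word k l else 0 := fun m => hp m l
    simp only [hl']
    rw [Finset.sum_ite_eq, if_pos (Finset.mem_range.2 hM)]

end IsWeightProj

end Components

/-! ### Commutativity of the associated graded algebra -/

section Commutativity

variable {k : Type*} [Field k]

theorem mul_mem_filtLT {w : ℕ+ → ℕ} (i : ℕ+) {n : ℕ} {u : UW k} (hu : u ∈ filtLT k w n) :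
    UW.e k i * u ∈ filtLT k w (w i + n) := by
  obtain ⟨t, ht, rfl⟩ := hu
  exact ⟨FreeAlgebra.ι k i * t,
    wordSpan_mul_left w i (fun a ha => Set.mem_Iio.2 (Nat.add_lt_add_left ha _)) ht,
    by simp [evalU_ι]⟩

/-- Exchanging two neighbouring letters `i`, `j` costs a multiple of a word in which they are merged
into the single letter `i + j`, of strictly smaller weight by `hw`. The strict inequality holds for
order and degree-order, but not for degree. -/
theorem evalU_word_sub_mem_filtLT {w : ℕ+ → ℕ} (hw : ∀ i j, w (i + j) < w i + w j)
    {l l' : List ℕ+} (h : l.Perm l') :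
    evalU k (word k l) - evalU k (word k l') ∈ filtLT k w (l.map w).sum := by
  induction h with
  | nil => simp
  | cons i _ ih =>
    rw [word_cons, word_cons, map_mul, map_mul, ← mul_sub, evalU_ι, List.map_cons, List.sum_cons]
    exact mul_mem_filtLT i ih
  | swap i j l =>
    have h : evalU k (word k (j :: i :: l)) - evalU k (word k (i :: j :: l)) =
        evalU k ((((i : ℕ) : k) - ((j : ℕ) : k)) • word k ((j + i) :: l)) := by
      simp only [word_cons, map_mul, map_smul, evalU_ι]
      rw [← smul_mul_assoc, ← UW.e_comm]
      noncomm_ring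
    rw [h]
    refine ⟨_, Submodule.smul_mem _ _ (word_mem_wordSpan ?_), rfl⟩
    have := hw j i
    simp only [List.map_cons, List.sum_cons, Set.mem_Iio]
    omega
  | trans h₁ _ ih₁ ih₂ =>
    rw [← (h₁.map w).sum_eq] at ih₂
    simpa using add_mem ih₁ ih₂

variable (k) in
/-- A linear section `S(W₊) → U(W₊)` of the symbol map: each monomial is sent to a product of its
factors in some order. -/
noncomputable def symbolSection : SymW k →ₗ[k] UW k :=
  ((MvPolynomial.basisMonomials ℕ+ k).constr k fun s =>
    evalU k (word k (Finsupp.toMultiset s).toList)) ∘ₗ (SymW.equivPoly k).toLinearMap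

theorem equivPoly_evalS_word (l : List ℕ+) : SymW.equivPoly k (evalS k (word k l)) =
    MvPolynomial.monomial (Multiset.toFinsupp (l : Multiset ℕ+)) 1 := by
  induction l with
  | nil => simp [word_nil]
  | cons i l ih =>
    have hi : SymW.equivPoly k (SymW.x k i) = MvPolynomial.X i :=
      SymmetricAlgebra.equivMvPolynomial_ι_apply (WittPos.basis k) i
    rw [word_cons, map_mul, map_mul, ih, evalS_ι, hi, MvPolynomial.X, MvPolynomial.monomial_mul,
      one_mul, ← Multiset.cons_coe, ← Multiset.singleton_add, map_add,
      Multiset.toFinsupp_singleton]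

/-- On a word, the section of its symbol is the same word with its letters permuted. -/
theorem evalU_sub_symbolSection_mem_filtLT {w : ℕ+ → ℕ} (hw : ∀ i j, w (i + j) < w i + w j)
    {m : ℕ} {t : FreeAlgebra k ℕ+} (ht : t ∈ wordSpan k w {m}) :
    evalU k t - symbolSection k (evalS k t) ∈ filtLT k w m := by
  induction ht using wordSpan_induction with
  | zero => simp
  | add x y _ _ hx hy =>
    simp only [map_add]
    rw [add_sub_add_comm]
    exact add_mem hx hy
  | smul a x _ hx =>
    simp only [map_smul]
    rw [← smul_sub]
    exact Submodule.smul_mem _ _ hx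
  | word l hl =>
    obtain rfl : (l.map w).sum = m := hl
    have h : symbolSection k (evalS k (word k l)) =
        evalU k (word k (l : Multiset ℕ+).toList) := by
      rw [symbolSection, LinearMap.comp_apply]
      change (MvPolynomial.basisMonomials ℕ+ k).constr k _ (SymW.equivPoly k _) = _
      rw [equivPoly_evalS_word, ← congrFun (MvPolynomial.coe_basisMonomials ℕ+ k),
        Module.Basis.constr_basis, Multiset.toFinsupp_toMultiset]
    rw [h]
    exact evalU_word_sub_mem_filtLT hw (Multiset.coe_eq_coe.1 (Multiset.coe_toList _).symm)

/-- The easy half of Poincaré–Birkhoff–Witt: a homogeneous element of `U(W₊)` is determined by its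
symbol modulo lower weight. -/
theorem evalU_mem_filtLT_of_evalS_eq_zero {w : ℕ+ → ℕ} (hw : ∀ i j, w (i + j) < w i + w j)
    {m : ℕ} {t : FreeAlgebra k ℕ+} (ht : t ∈ wordSpan k w {m}) (h : evalS k t = 0) :
    evalU k t ∈ filtLT k w m := by
  simpa [h] using evalU_sub_symbolSection_mem_filtLT hw ht

end Commutativity

/-! ### Comparing an ideal with its associated graded ideals -/

section Comparison

variable {k : Type*} [Field k]

/-- `gr_d(J)` is homogeneous. -/
theorem weightProj_mem_grD {c : ℕ → UW k →ₗ[k] UW k}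
    (hc : IsWeightProj (fun i => (i : ℕ)) (evalU k) c) (J : Ideal (UW k)) (m : ℕ) {u : UW k}
    (hu : u ∈ grD J) : c m u ∈ grD J := by
  change u ∈ grSpan _ (evalU k) J at hu
  change c m u ∈ grSpan _ (evalU k) J
  induction hu using Submodule.span_induction with
  | zero => simp
  | add x y _ _ hx hy => rw [map_add]; exact add_mem hx hy
  | smul a x _ hx => rw [map_smul]; exact Submodule.smul_mem _ _ hx
  | mem y hy =>
    obtain ⟨n, t, ht, rfl, h⟩ := hy
    rw [hc.apply_of_mem ht]
    split_ifs
    · exact Submodule.subset_span ⟨n, t, ht, rfl, h⟩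
    · exact zero_mem _

/-- Passing from one filtration weight to another on symbols, one degree at a time: if on words of
each fixed degree `d` the weights `w` and `w'` determine each other, order-preservingly, then the
`w`-symbols of a homogeneous ideal are sums of `w'`-symbols. -/
theorem grSpan_evalS_le_of_homogeneous {w w' : ℕ+ → ℕ} {I : Ideal (UW k)}
    {c : ℕ → UW k →ₗ[k] UW k} (hc : IsWeightProj (fun i => (i : ℕ)) (evalU k) c)
    (hI : ∀ m, ∀ u ∈ I, c m u ∈ I) (r : ℕ → ℕ → ℕ)
    (heq : ∀ l : List ℕ+, (l.map w').sum = r (l.map w).sum (l.map fun i : ℕ+ => (i : ℕ)).sum)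
    (hlt : ∀ l : List ℕ+, ∀ n, (l.map w).sum < n →
      (l.map w').sum < r n (l.map fun i : ℕ+ => (i : ℕ)).sum) :
    grSpan w (evalS k) I ≤ grSpan w' (evalS k) I := by
  obtain ⟨p, hp⟩ := exists_isWeightProj_freeAlgebra k fun i => (i : ℕ)
  refine Submodule.span_le.2 ?_
  rintro _ ⟨n, t, ht, rfl, f, hf, v, hv, hvf⟩
  obtain ⟨N, hN⟩ := hp.exists_eq_sum t
  rw [hN N le_rfl, map_sum]
  -- The component `p m t` consists of words of `w`-weight `n` and degree `m`, hence of `w'`-weight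
  -- `r n m`. Its witness is the degree-`m` component of `f`, which lies in `I` by homogeneity.
  refine sum_mem fun m _ => Submodule.subset_span
    ⟨r n m, p m t, hp.mem_wordSpan ?_ ht, rfl, c m f, hI m f hf, p m v, hp.mem_wordSpan ?_ hv, ?_⟩
  · rintro l hl rfl
    obtain rfl : (l.map w).sum = n := hl
    exact heq l
  · rintro l hl rfl
    exact hlt l n hl
  · change evalU k v = _ at hvf
    change evalU k (p m v) = _
    rw [← hc.comp_eq hp, ← hc.comp_eq hp, hvf, map_sub]

theorem sum_map_degree_add_one (l : List ℕ+) :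
    (l.map fun i : ℕ+ => (i : ℕ) + 1).sum =
      (l.map fun i : ℕ+ => (i : ℕ)).sum + (l.map fun _ => 1).sum := by
  induction l with
  | nil => simp
  | cons i l ih =>
    simp only [List.map_cons, List.sum_cons, ih]
    ring

/-- For the homogeneous ideal `gr_d(J)`, order symbols and degree-order symbols agree. -/
theorem grO_grD_eq_grDO_grD (J : Ideal (UW k)) : grO (grD J) = grDO (grD J) := by
  obtain ⟨c, hc⟩ := exists_isWeightProj_evalU k
  have hI : ∀ m, ∀ u ∈ grD J, c m u ∈ grD J := fun m u hu => weightProj_mem_grD hc J m hu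
  refine le_antisymm (show grSpan _ (evalS k) _ ≤ grSpan _ (evalS k) _ from ?_)
    (show grSpan _ (evalS k) _ ≤ grSpan _ (evalS k) _ from ?_)
  · refine grSpan_evalS_le_of_homogeneous hc hI (fun n d => d + n) sum_map_degree_add_one ?_
    intro l n hl
    rw [sum_map_degree_add_one]
    omega
  -- Truncated subtraction is harmless: a word of degree `d` has degree-order weight at least `d`.
  · refine grSpan_evalS_le_of_homogeneous hc hI (fun n d => n - d) ?_ ?_
    · intro l
      rw [sum_map_degree_add_one]
      omega
    · intro l n hl
      rw [sum_map_degree_add_one] at hl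
      omega

/-- Modulo lower degree, homogeneous elements lie in `J` if and only if they lie in `gr_d(J)`. -/
theorem exists_sub_mem_iff_grD (J : Ideal (UW k)) {m : ℕ} {t : FreeAlgebra k ℕ+}
    (ht : t ∈ wordSpan k (fun i => (i : ℕ)) {m}) :
    (∃ v ∈ filtLT k (fun i => (i : ℕ)) m, evalU k t - v ∈ J) ↔
      ∃ v ∈ filtLT k (fun i => (i : ℕ)) m, evalU k t - v ∈ grD J := by
  constructor
  · rintro ⟨v, hv, h⟩
    -- No correction is needed: `evalU k t` is itself a generator of `gr_d(J)`, being the degree-`m`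
    -- leading part of the given element of `J`.
    refine ⟨0, zero_mem _, ?_⟩
    rw [sub_zero]
    refine Submodule.subset_span (R := k) ⟨m, t, ht, rfl, _, h, ?_⟩
    rw [sub_sub_cancel_left]
    exact neg_mem hv
  · obtain ⟨c, hc⟩ := exists_isWeightProj_evalU k
    -- An element of `gr_d(J)` mixes leading parts of several degrees. Projecting to degree `m`
    -- keeps only those of degree `m`, and the corresponding elements of `J` may then be added
    -- without their lower terms interfering.
    have key : ∀ u ∈ grSpan (fun i => (i : ℕ)) (evalU k) J,
        ∃ v ∈ filtLT k (fun i => (i : ℕ)) m, c m u - v ∈ J := by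
      intro u hu
      induction hu using Submodule.span_induction with
      | zero => exact ⟨0, zero_mem _, by simp⟩
      | add x y _ _ hx hy =>
        obtain ⟨v, hv, h⟩ := hx
        obtain ⟨v', hv', h'⟩ := hy
        refine ⟨v + v', add_mem hv hv', ?_⟩
        rw [map_add, add_sub_add_comm]
        exact add_mem h h'
      | smul a x _ hx =>
        obtain ⟨v, hv, h⟩ := hx
        refine ⟨a • v, Submodule.smul_mem _ _ hv, ?_⟩
        rw [map_smul, ← smul_sub]
        exact Submodule.smul_of_tower_mem J a h
      | mem y hy =>
        obtain ⟨n, t₀, ht₀, rfl, f, hf, h⟩ := hy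
        rw [hc.apply_of_mem ht₀]
        split_ifs with hnm
        · subst hnm
          refine ⟨-(f - evalU k t₀), neg_mem h, ?_⟩
          rwa [sub_neg_eq_add, add_sub_cancel]
        · exact ⟨0, zero_mem _, by simp⟩
    rintro ⟨_, ⟨v, hv, rfl⟩, h⟩
    have h' := key _ h
    rw [map_sub, hc.apply_of_mem ht, if_pos rfl, AlgHom.toLinearMap_apply,
      hc.apply_eq_zero_of_mem_Iio hv, sub_zero] at h'
    exact h'

/-- Modulo lower weight, a homogeneous element lies in `I` if and only if its symbol lies in
`gr(I)`. -/
theorem exists_sub_mem_iff_grSpan_evalS {w : ℕ+ → ℕ} (hw : ∀ i j, w (i + j) < w i + w j)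
    (I : Ideal (UW k)) {m : ℕ} {t : FreeAlgebra k ℕ+} (ht : t ∈ wordSpan k w {m}) :
    (∃ v ∈ filtLT k w m, evalU k t - v ∈ I) ↔
      ∃ v ∈ wordSpan k w (Set.Iio m), evalS k t - evalS k v ∈ grSpan w (evalS k) I := by
  constructor
  · rintro ⟨v, hv, h⟩
    -- The symbol of `t` lies in the associated graded space exactly, so no lower correction is
    -- needed.
    refine ⟨0, zero_mem _, ?_⟩
    rw [map_zero, sub_zero]
    refine Submodule.subset_span ⟨m, t, ht, rfl, _, h, ?_⟩
    rw [sub_sub_cancel_left]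
    exact neg_mem hv
  · obtain ⟨c, hc⟩ := exists_isWeightProj_evalS k w
    -- The projection now acts on `S(W₊)`, whereas membership in `I` concerns `U(W₊)`. So a
    -- homogeneous lift `t'` of the projected symbol is carried along.
    have key : ∀ s ∈ grSpan w (evalS k) I, ∃ t' ∈ wordSpan k w {m}, evalS k t' = c m s ∧
        ∃ v ∈ filtLT k w m, evalU k t' - v ∈ I := by
      intro s hs
      induction hs using Submodule.span_induction with
      | zero => exact ⟨0, zero_mem _, by simp, 0, zero_mem _, by simp⟩
      | add x y _ _ hx hy =>
        obtain ⟨x', hx', hxs, v, hv, h⟩ := hx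
        obtain ⟨y', hy', hys, v', hv', h'⟩ := hy
        refine ⟨x' + y', add_mem hx' hy', by rw [map_add, map_add, hxs, hys],
          v + v', add_mem hv hv', ?_⟩
        rw [map_add, add_sub_add_comm]
        exact add_mem h h'
      | smul a x _ hx =>
        obtain ⟨x', hx', hxs, v, hv, h⟩ := hx
        refine ⟨a • x', Submodule.smul_mem _ _ hx', by rw [map_smul, map_smul, hxs],
          a • v, Submodule.smul_mem _ _ hv, ?_⟩
        rw [map_smul, ← smul_sub]
        exact Submodule.smul_of_tower_mem I a h
      | mem y hy =>
        obtain ⟨n, t₀, ht₀, rfl, f, hf, h⟩ := hy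
        rw [hc.apply_of_mem ht₀]
        split_ifs with hnm
        · subst hnm
          refine ⟨t₀, ht₀, rfl, -(f - evalU k t₀), neg_mem h, ?_⟩
          rwa [sub_neg_eq_add, add_sub_cancel]
        · exact ⟨0, zero_mem _, by simp, 0, zero_mem _, by simp⟩
    rintro ⟨v, hv, h⟩
    obtain ⟨t', ht', hts, u, hu, h'⟩ := key _ h
    rw [map_sub, hc.apply_of_mem ht, if_pos rfl, hc.apply_eq_zero_of_mem_Iio hv, sub_zero] at hts
    -- The given `t` and the lift `t'` have the same symbol, so their values in `U(W₊)` differ by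
    -- lower weight, which joins the correction term.
    have h0 := evalU_mem_filtLT_of_evalS_eq_zero hw (sub_mem ht ht')
      (by rw [map_sub, hts, sub_self])
    refine ⟨evalU k (t - t') + u, add_mem h0 hu, ?_⟩
    rwa [map_sub, sub_add_eq_sub_sub, sub_sub_cancel]

/-- Membership in a filtered piece of a quotient. -/
theorem mkₐ_mem_map_iff {B : Type*} [Ring B] [Algebra k B] (φ : FreeAlgebra k ℕ+ →ₐ[k] B)
    (J : Ideal B) [J.IsTwoSided] (P : Submodule k (FreeAlgebra k ℕ+)) (t : FreeAlgebra k ℕ+) :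
    ((Ideal.Quotient.mkₐ k J).comp φ).toLinearMap t ∈
        P.map ((Ideal.Quotient.mkₐ k J).comp φ).toLinearMap ↔
      ∃ v ∈ P, φ t - φ v ∈ J := by
  simp only [Submodule.mem_map, AlgHom.toLinearMap_apply, AlgHom.comp_apply,
    Ideal.Quotient.mkₐ_eq_mk]
  refine exists_congr fun v => and_congr_right fun _ => ?_
  rw [eq_comm, Ideal.Quotient.eq]

theorem exists_filtLT_iff (w : ℕ+ → ℕ) (m : ℕ) (q : UW k → Prop) :
    (∃ v ∈ filtLT k w m, q v) ↔ ∃ v ∈ wordSpan k w (Set.Iio m), q (evalU k v) := by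
  simp [filtLT, Submodule.mem_map]

/-- Any weight filtration computes the Gelfand–Kirillov dimension of a quotient of `U(W₊)`. -/
theorem GKdim_quotient_eq [CharZero k] (J : Ideal (UW k)) [J.IsTwoSided] {w : ℕ+ → ℕ}
    (hw : ∀ i : ℕ+, (i : ℕ) ≤ w i) :
    GKdim k (UW k ⧸ J) = growthExponent fun n =>
      Module.finrank k (weightLE w ((Ideal.Quotient.mkₐ k J).comp (evalU k)) n) := by
  refine GKdim_eq_growthExponent_weightLE hw
    ((Ideal.Quotient.mkₐ_surjective k J).comp (evalU_surjective k)) fun i j => ?_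
  simp only [AlgHom.comp_apply, evalU_ι]
  rw [← map_mul, ← map_mul, ← map_sub, UW.e_comm, map_smul]

theorem PGKdim_quotient_eq [CharZero k] (K : Ideal (SymW k)) [IsPoissonIdeal k K] {w : ℕ+ → ℕ}
    (hw : ∀ i : ℕ+, (i : ℕ) ≤ w i) (hadd : ∀ i j, w (i + j) ≤ w i + w j) :
    PGKdim k (SymW k ⧸ K) = growthExponent fun n =>
      Module.finrank k (weightLE w ((Ideal.Quotient.mkₐ k K).comp (evalS k)) n) := by
  refine PGKdim_eq_growthExponent_weightLE hw hadd
    ((Ideal.Quotient.mkₐ_surjective k K).comp (evalS_surjective k)) fun i j => ?_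
  simp only [AlgHom.comp_apply, evalS_ι]
  rw [← map_smul, ← SymW.pb_x]
  rfl

theorem Iic_eq_Iio_succ (n : ℕ) : Set.Iic n = Set.Iio (n + 1) := by
  ext a
  exact Nat.lt_succ_iff.symm

end Comparison

theorem theorem3p15 (k : Type*) [Field k] [CharZero k] (J : Ideal (UW k)) [J.IsTwoSided] :
    grO (grD J) = grDO (grD J) ∧
      GKdim k (UW k ⧸ J) = GKdim k (UW k ⧸ grD J) ∧
      GKdim k (UW k ⧸ grD J) = PGKdim k (SymW k ⧸ grO (grD J)) := by
  refine ⟨grO_grD_eq_grDO_grD J, ?_, ?_⟩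
  -- Both quotients of `U(W₊)` are filtered by degree.
  · have hw : ∀ i : ℕ+, (i : ℕ) ≤ i := fun _ => le_rfl
    rw [GKdim_quotient_eq J hw, GKdim_quotient_eq (grD J) hw]
    congr 1
    funext n
    rw [weightLE, weightLE, Iic_eq_Iio_succ]
    refine finrank_map_wordSpan_eq hw _ _ (fun m t ht => ?_) _
    rw [mkₐ_mem_map_iff, mkₐ_mem_map_iff,
      ← exists_filtLT_iff _ _ fun v => evalU k t - v ∈ J,
      ← exists_filtLT_iff _ _ fun v => evalU k t - v ∈ grD J]
    exact exists_sub_mem_iff_grD J ht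
  -- The quotient by `gr_d(J)` is now measured by degree-order instead, whose pieces are
  -- finite-dimensional and for which commutators drop strictly.
  · have hw : ∀ i : ℕ+, (i : ℕ) ≤ (i : ℕ) + 1 := fun i => Nat.le_succ _
    have hadd : ∀ i j : ℕ+, ((i + j : ℕ+) : ℕ) + 1 < ((i : ℕ) + 1) + ((j : ℕ) + 1) := fun i j => by
      rw [PNat.add_coe]
      omega
    rw [GKdim_quotient_eq (grD J) hw, PGKdim_quotient_eq _ hw fun i j => (hadd i j).le]
    congr 1
    funext n
    rw [weightLE, weightLE, Iic_eq_Iio_succ]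
    refine finrank_map_wordSpan_eq hw _ _ (fun m t ht => ?_) _
    -- Degree-order controls `gr_do`, so the equality of the two symbol ideals is needed to reach
    -- `gr_o`.
    rw [mkₐ_mem_map_iff, mkₐ_mem_map_iff,
      ← exists_filtLT_iff _ _ fun v => evalU k t - v ∈ grD J, grO_grD_eq_grDO_grD]
    exact exists_sub_mem_iff_grSpan_evalS hadd (grD J) ht
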